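/- Let $p$ be an odd prime. A finite $p$-group is a UCS group if it has exactly one characteristic subgroup that is non-trivial and proper. An algebra over $\mathbb F_p$ is a vector space $L$ with a bilinear (not necessarily associative) product; it is an IAC algebra if $xx=0$ for all $x\in L$ and $L\neq 0$ has no subspaces invariant under $\mathrm{Aut}(L)$ other than $0$ and $L$. For a finite UCS $p$-group $G$ of exponent $p^2$ with Frattini subgroup $\Phi(G)$, the quotient $G/\Phi(G)$ is a vector space over $\mathbb F_p$ and $x\Phi(G)\mapsto x^p$ is a well-defined isomorphism $G/\Phi(G)\to\Phi(G)$; write $h\mapsto h^{1/p}$ for its inverse. Let $L(G)$ be the vector space $G/\Phi(G)$ with the (well-defined, bilinear) product $\overline x\,\overline y=[x,y]^{1/p}$, where $\overline x=x\Phi(G)$ and $[x,y]=x^{-1}y^{-1}xy$. Then $L(G)$ is an IAC algebra, and $G\mapsto L(G)$ induces a bijection from the set of isomorphism classes of finite UCS $p$-groups of exponent $p^2$ to the set of isomorphism classes of finite-dimensional IAC algebras over $\mathbb F_p$. Moreover, for every finite UCS $p$-group $G$ of exponent $p^2$, with $L=L(G)$ and $r$ the minimal number of generators of $G$, the following hold.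 (a) Let $K$ be the group of automorphisms of $G$ that induce the identity on $G/\Phi(G)$. Letting $\alpha\in\mathrm{Aut}(G)$ act on $L$ by $\overline g\mapsto\overline{\alpha(g)}$ induces an isomorphism $\mathrm{Aut}(G)/K\cong\mathrm{Aut}(L)$. The group $K$ is elementary abelian of order $p^{r^2}$, and $\dim L=r$. If $G$ is non-abelian, then $K=\mathrm{Aut}_C(G)$, the group of central automorphisms of $G$ (those inducing the identity on $G/Z(G)$), so that $\mathrm{Aut}(G)/\mathrm{Aut}_C(G)\cong\mathrm{Aut}(L)$ and $\mathrm{Aut}_C(G)$ is elementary abelian of order $p^{r^2}$. (b) The map $H\mapsto H/\Phi(G)$ is a bijection from the set of powerful subgroups $H$ of $G$ containing $\Phi(G)$ (those with $[H,H]\le H^p$, where $H^p$ is the subgroup generated by the $p$-th powers of elements of $H$) to the set of subalgebras of $L$. (c) This bijection restricts to a bijection between the powerfully embedded subgroups $H$ of $G$ containing $\Phi(G)$ (those with $[H,G]\le H^p$) and the ideals of $L$. (d) For every $k\ge 1$, the direct power $G^{\times k}$ is a finite UCS $p$-group of exponent $p^2$, and $L(G^{\times k})\cong L^{\oplus k}$.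 -/

import Mathlib

universe u

namespace UCSIAC

/-! ### Anti-commutative algebras

A (not necessarily associative) algebra over a field `F` is a `NonUnitalNonAssocRing` together with
an `F`-module structure for which the product is `F`-bilinear (`IsScalarTower`, `SMulCommClass`).
The product of `x` and `y` is written `x * y`. -/

section Algebras

/-- The automorphism group of an algebra, as a subgroup of its general linear group. -/
def algAut (F L : Type*) [Field F] [NonUnitalNonAssocRing L] [Module F L] :
    Subgroup (L ≃ₗ[F] L) where
  carrier := {f | ∀ x y, f (x * y) = f x * f y}
  one_mem' := fun _ _ => rfl
  mul_mem' := by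
    intro f g hf hg x y
    change f (g (x * y)) = f (g x) * f (g y)
    rw [hg, hf]
  inv_mem' := by
    intro f hf x y
    change f.symm (x * y) = f.symm x * f.symm y
    apply f.injective
    rw [hf]
    simp

/-- Two algebras over `F` are isomorphic. -/
def AlgIso (F L M : Type*) [Field F] [NonUnitalNonAssocRing L] [Module F L]
    [NonUnitalNonAssocRing M] [Module F M] : Prop :=
  ∃ e : L ≃ₗ[F] M, ∀ x y, e (x * y) = e x * e y

/-- `L` is an IAC algebra: `x * x = 0` for all `x`, and the automorphism group of `L` acts
irreducibly on `L`. -/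
structure IsIAC (F L : Type*) [Field F] [NonUnitalNonAssocRing L] [Module F L]
    [IsScalarTower F L L] [SMulCommClass F L L] : Prop where
  mul_self : ∀ x : L, x * x = 0
  nontrivial : Nontrivial L
  irreducible : ∀ W : Submodule F L,
    (∀ f ∈ algAut F L, ∀ w ∈ W, f w ∈ W) → W = ⊥ ∨ W = ⊤

/-- A subalgebra is an ideal. -/
def IsIdealOf {F L : Type*} [Field F] [NonUnitalNonAssocRing L] [Module F L]
    (I : NonUnitalSubalgebra F L) : Prop :=
  ∀ x ∈ I, ∀ y : L, x * y ∈ I ∧ y * x ∈ I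

/-- Bundled finite-dimensional IAC algebras over the field with `p` elements. -/
structure IACAlg (p : ℕ) [Fact p.Prime] : Type (u + 1) where
  carrier : Type u
  [ring : NonUnitalNonAssocRing carrier]
  [module : Module (ZMod p) carrier]
  [scalarTower : IsScalarTower (ZMod p) carrier carrier]
  [smulComm : SMulCommClass (ZMod p) carrier carrier]
  [finite : Module.Finite (ZMod p) carrier]
  isIAC : IsIAC (ZMod p) carrier

attribute [instance] IACAlg.ring IACAlg.module IACAlg.scalarTower IACAlg.smulComm IACAlg.finite

/-- Isomorphism of finite-dimensional IAC algebras. -/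
instance iacSetoid (p : ℕ) [Fact p.Prime] : Setoid (IACAlg.{u} p) where
  r L M := AlgIso (ZMod p) L.carrier M.carrier
  iseqv :=
    { refl := fun _ => ⟨LinearEquiv.refl _ _, fun _ _ => rfl⟩
      symm := by
        rintro L M ⟨e, he⟩
        refine ⟨e.symm, fun x y => e.injective ?_⟩
        rw [he]
        simp
      trans := by
        rintro L M N ⟨e, he⟩ ⟨f, hf⟩
        exact ⟨e.trans f, fun x y => by simp [he, hf]⟩ }

/-- The set of isomorphism classes of finite-dimensional IAC algebras over the field with `p`
elements. -/
def IACClasses (p : ℕ) [Fact p.Prime] : Type (u + 1) := Quotient (iacSetoid.{u} p)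

/-- The isomorphism class of a finite-dimensional IAC algebra. -/
def IACClasses.mk (p : ℕ) [Fact p.Prime] (L : Type u) [NonUnitalNonAssocRing L]
    [Module (ZMod p) L] [IsScalarTower (ZMod p) L L] [SMulCommClass (ZMod p) L L]
    [Module.Finite (ZMod p) L] (h : IsIAC (ZMod p) L) : IACClasses.{u} p :=
  Quotient.mk (iacSetoid.{u} p) ⟨L, h⟩

end Algebras

/-! ### UCS groups -/

section Groups

/-- `G` is a finite UCS `p`-group of exponent `p ^ 2` (finiteness of `G` is kept as a separate
instance): it has a unique characteristic subgroup that is non-trivial and proper. -/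
class IsUCSPSq (p : ℕ) (G : Type*) [Group G] : Prop where
  isPGroup : IsPGroup p G
  exponent : Monoid.exponent G = p ^ 2
  ucs : ∃! N : Subgroup G, N.Characteristic ∧ N ≠ ⊥ ∧ N ≠ ⊤

/-- Bundled finite UCS `p`-groups of exponent `p ^ 2`. -/
structure UCSGrp (p : ℕ) : Type (u + 1) where
  carrier : Type u
  [group : Group carrier]
  [finite : Finite carrier]
  [isUCS : IsUCSPSq p carrier]

attribute [instance] UCSGrp.group UCSGrp.finite UCSGrp.isUCS

/-- Isomorphism of finite UCS `p`-groups of exponent `p ^ 2`. -/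
instance ucsSetoid (p : ℕ) : Setoid (UCSGrp.{u} p) where
  r G H := Nonempty (G.carrier ≃* H.carrier)
  iseqv :=
    { refl := fun _ => ⟨MulEquiv.refl _⟩
      symm := fun ⟨e⟩ => ⟨e.symm⟩
      trans := fun ⟨e⟩ ⟨f⟩ => ⟨e.trans f⟩ }

/-- The set of isomorphism classes of finite UCS `p`-groups of exponent `p ^ 2`. -/
def UCSClasses (p : ℕ) : Type (u + 1) := Quotient (ucsSetoid.{u} p)

/-- The isomorphism class of a finite UCS `p`-group of exponent `p ^ 2`. -/
def UCSClasses.mk (p : ℕ) (G : Type u) [Group G] [Finite G] [IsUCSPSq p G] : UCSClasses.{u} p :=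
  Quotient.mk (ucsSetoid.{u} p) ⟨G⟩

/-- The natural homomorphism from `Aut(G)` to `Aut(G / N)`, for `N` characteristic in `G`. -/
def autQuotient {G : Type*} [Group G] (N : Subgroup G) [hN : N.Characteristic] :
    MulAut G →* MulAut (G ⧸ N) where
  toFun α := QuotientGroup.congr N N α (Subgroup.characteristic_iff_map_eq.1 hN α)
  map_one' := by
    ext x
    induction x using QuotientGroup.induction_on
    rfl
  map_mul' := by
    intro α β
    ext x
    induction x using QuotientGroup.induction_on
    rfl

/-- The group of central automorphisms: those inducing the identity on `G / Z(G)`. -/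
def centralAut (G : Type*) [Group G] : Subgroup (MulAut G) :=
  (autQuotient (Subgroup.center G)).ker

/-- The group of automorphisms inducing the identity on `G / Φ(G)`. -/
def frattiniAut (G : Type*) [Group G] : Subgroup (MulAut G) :=
  (autQuotient (frattini G)).ker

instance frattiniAut_normal (G : Type*) [Group G] : (frattiniAut G).Normal :=
  MonoidHom.normal_ker _

/-- The subgroup generated by the `n`-th powers of the elements of `H`. -/
def powersSubgroup {G : Type*} [Group G] (n : ℕ) (H : Subgroup G) : Subgroup G :=
  Subgroup.closure {x | ∃ h ∈ H, h ^ n = x}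

/-- A subgroup of a finite `p`-group, `p` odd, is powerful. -/
def IsPowerful (p : ℕ) {G : Type*} [Group G] (H : Subgroup G) : Prop :=
  ⁅H, H⁆ ≤ powersSubgroup p H

/-- A subgroup of a finite `p`-group, `p` odd, is powerfully embedded. -/
def IsPowerfullyEmbedded (p : ℕ) {G : Type*} [Group G] (H : Subgroup G) : Prop :=
  ⁅H, (⊤ : Subgroup G)⁆ ≤ powersSubgroup p H

end Groups

/-! ### Basic facts needed to define the algebra of a UCS group -/

section Facts

theorem pow_mul_of_central {G : Type*} [Group G] {x y c : G} (hc : ∀ g, c * g = g * c)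
    (h : y * x = x * y * c) (n : ℕ) : y ^ n * x = x * y ^ n * c ^ n := by
  have hcn : ∀ n : ℕ, ∀ g, c ^ n * g = g * c ^ n := fun n g => Commute.pow_left (hc g) n
  induction n with
  | zero => simp
  | succ n ih =>
    calc y ^ (n + 1) * x = y ^ n * (y * x) := by rw [pow_succ, mul_assoc]
      _ = (y ^ n * x) * y * c := by rw [h]; group
      _ = x * y ^ n * (c ^ n * y) * c := by rw [ih]; group
      _ = x * y ^ (n + 1) * c ^ (n + 1) := by rw [hcn, pow_succ, pow_succ]; group

theorem mul_pow_of_central {G : Type*} [Group G] {x y c : G} (hc : ∀ g, c * g = g * c)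
    (h : y * x = x * y * c) (n : ℕ) : (x * y) ^ n = x ^ n * y ^ n * c ^ (n * (n - 1) / 2) := by
  have hcn : ∀ n : ℕ, ∀ g, c ^ n * g = g * c ^ n := fun n g => Commute.pow_left (hc g) n
  induction n with
  | zero => simp
  | succ n ih =>
    have e : (n + 1) * (n + 1 - 1) / 2 = n * (n - 1) / 2 + n := by
      simpa [Finset.sum_range_id] using Finset.sum_range_succ (fun i => i) n
    calc (x * y) ^ (n + 1)
        = x ^ n * y ^ n * (c ^ (n * (n - 1) / 2) * (x * y)) := by rw [pow_succ, ih]; group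
      _ = x ^ n * (y ^ n * x) * y * c ^ (n * (n - 1) / 2) := by
          rw [hcn]; simp only [mul_assoc]
      _ = x ^ n * x * y ^ n * (c ^ n * y) * c ^ (n * (n - 1) / 2) := by
          rw [pow_mul_of_central hc h]; group
      _ = x ^ (n + 1) * y ^ (n + 1) * (c ^ (n * (n - 1) / 2) * c ^ n) := by
          rw [hcn, hcn (n * (n - 1) / 2), pow_succ, pow_succ]
          simp only [mul_assoc]
      _ = _ := by rw [← pow_add, e]

variable {p : ℕ} [Fact p.Prime] {G : Type u} [Group G] [Finite G]

theorem coatom_facts (hG : IsPGroup p G) {M : Subgroup G} (hM : IsCoatom M) :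
    (∀ x, x ^ p ∈ M) ∧ ∀ x y : G, x⁻¹ * y⁻¹ * x * y ∈ M := by
  have hnil := hG.isNilpotent
  have hn : M.Normal := ((Group.isNilpotent_of_finite_tfae (G := G)).out 0 2 rfl rfl).1 hnil M hM
  have key : ∀ K : Subgroup (G ⧸ M), K ≠ ⊥ → K = ⊤ := by
    intro K hK
    have hle : M ≤ K.comap (QuotientGroup.mk' M) := by
      intro m hm
      have : QuotientGroup.mk' M m = 1 := (QuotientGroup.eq_one_iff m).2 hm
      rw [Subgroup.mem_comap, this]
      exact K.one_mem
    have hsur := QuotientGroup.mk'_surjective M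
    rcases hM.le_iff.1 hle with h | h
    · rw [← Subgroup.map_comap_eq_self_of_surjective hsur K, h,
        Subgroup.map_top_of_surjective _ hsur]
    · refine absurd ?_ hK
      rw [← Subgroup.map_comap_eq_self_of_surjective hsur K, h, Subgroup.map_eq_bot_iff]
      simp
  have hnt : Nontrivial (G ⧸ M) := QuotientGroup.nontrivial_iff.2 hM.1
  have hQ : IsPGroup p (G ⧸ M) := hG.to_quotient M
  have hcen : Subgroup.center (G ⧸ M) = ⊤ := key _ hQ.bot_lt_center.ne'
  have hcomm : ∀ a b : G ⧸ M, a * b = b * a := fun a b =>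
    (Subgroup.mem_center_iff.1 (hcen ▸ Subgroup.mem_top b : b ∈ Subgroup.center (G ⧸ M))) a
  let P : Subgroup (G ⧸ M) :=
    { carrier := {a | a ^ p = 1}
      one_mem' := one_pow p
      mul_mem' := fun {a b} ha hb => by
        change (a * b) ^ p = 1
        rw [(show Commute a b from hcomm a b).mul_pow, ha, hb, one_mul]
      inv_mem' := fun {a} ha => by
        change a⁻¹ ^ p = 1
        rw [inv_pow, ha, inv_one] }
  have hP : P = ⊤ := by
    apply key
    obtain ⟨n, hn0, hcard⟩ := hQ.nontrivial_iff_card.mp hnt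
    obtain ⟨a, ha⟩ := exists_prime_orderOf_dvd_card' (G := G ⧸ M) p
      (hcard ▸ dvd_pow_self p hn0.ne')
    intro h
    have : a ∈ P := by
      change a ^ p = 1
      rw [← ha, pow_orderOf_eq_one]
    rw [h, Subgroup.mem_bot] at this
    rw [this, orderOf_one] at ha
    exact (Fact.out : p.Prime).one_lt.ne ha
  refine ⟨fun x => (QuotientGroup.eq_one_iff _).1 ?_, fun x y => (QuotientGroup.eq_one_iff _).1 ?_⟩
  · exact (hP ▸ Subgroup.mem_top (x : G ⧸ M) : (x : G ⧸ M) ∈ P)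
  · change (x : G ⧸ M)⁻¹ * (y : G ⧸ M)⁻¹ * x * y = 1
    rw [mul_assoc, hcomm (x : G ⧸ M) y]
    group

theorem pow_mem_frattini (hG : IsPGroup p G) (x : G) : x ^ p ∈ frattini G := by
  simp only [frattini, Order.radical, Subgroup.mem_iInf]
  exact fun M hM => (coatom_facts hG hM).1 x

theorem comm_mem_frattini (hG : IsPGroup p G) (x y : G) : x⁻¹ * y⁻¹ * x * y ∈ frattini G := by
  simp only [frattini, Order.radical, Subgroup.mem_iInf]
  exact fun M hM => (coatom_facts hG hM).2 x y

theorem exists_pow_ne_one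
    (p : ℕ) [Fact p.Prime] (G : Type u) [Group G] [Finite G] [IsUCSPSq p G]
    : ∃ x : G, x ^ p ≠ 1 := by
  by_contra! h
  have h1 := Monoid.exponent_dvd_of_forall_pow_eq_one h
  rw [IsUCSPSq.exponent (p := p) (G := G)] at h1
  have hp := (Fact.out : p.Prime)
  have := Nat.le_of_dvd hp.pos h1
  nlinarith [hp.one_lt]

theorem nontrivial_of_ucs
    (p : ℕ) [Fact p.Prime] (G : Type u) [Group G] [Finite G] [IsUCSPSq p G]
    : Nontrivial G := by
  obtain ⟨x, hx⟩ := exists_pow_ne_one p G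
  exact ⟨⟨x ^ p, 1, hx⟩⟩

theorem frattini_ne_top
    (p : ℕ) [Fact p.Prime] (G : Type u) [Group G] [Finite G] [IsUCSPSq p G]
    : frattini G ≠ ⊤ := by
  have := nontrivial_of_ucs p G
  obtain h | ⟨M, hM, -⟩ := eq_top_or_exists_le_coatom (⊥ : Subgroup G)
  · exact absurd h bot_ne_top
  · exact fun h => hM.1 (top_le_iff.1 (h ▸ frattini_le_coatom hM))

theorem frattini_ne_bot
    (p : ℕ) [Fact p.Prime] (G : Type u) [Group G] [Finite G] [IsUCSPSq p G]
    : frattini G ≠ ⊥ := by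
  obtain ⟨x, hx⟩ := exists_pow_ne_one p G
  intro h
  have := pow_mem_frattini (IsUCSPSq.isPGroup (p := p)) x
  rw [h, Subgroup.mem_bot] at this
  exact hx this

/-- The characteristic subgroups of `G` are `1`, `Φ(G)` and `G`. -/
theorem char_cases
    (p : ℕ) [Fact p.Prime] (G : Type u) [Group G] [Finite G] [IsUCSPSq p G]
    (K : Subgroup G) (hK : K.Characteristic) :
    K = ⊥ ∨ K = frattini G ∨ K = ⊤ := by
  by_contra! h
  exact h.2.1 ((IsUCSPSq.ucs (p := p) (G := G)).unique ⟨hK, h.1, h.2.2⟩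
    ⟨frattini_characteristic, frattini_ne_bot p G, frattini_ne_top p G⟩)

theorem frattini_le_of_char
    (p : ℕ) [Fact p.Prime] (G : Type u) [Group G] [Finite G] [IsUCSPSq p G]
    (K : Subgroup G) (hK : K.Characteristic) (h : K ≠ ⊥) :
    frattini G ≤ K := by
  rcases char_cases p G K hK with h' | h' | h'
  · exact absurd h' h
  · exact h'.ge
  · exact h' ▸ le_top

theorem central_of_mem_frattini
    (p : ℕ) [Fact p.Prime] (G : Type u) [Group G] [Finite G] [IsUCSPSq p G]
    {z : G} (hz : z ∈ frattini G) (g : G) : z * g = g * z := by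
  have := nontrivial_of_ucs p G
  have h : frattini G ≤ Subgroup.center G := frattini_le_of_char p G _ inferInstance
    (IsUCSPSq.isPGroup (p := p) (G := G)).bot_lt_center.ne'
  exact (Subgroup.mem_center_iff.1 (h hz) g).symm

theorem pow_eq_one_of_mem_frattini
    (p : ℕ) [Fact p.Prime] (G : Type u) [Group G] [Finite G] [IsUCSPSq p G]
    {z : G} (hz : z ∈ frattini G) : z ^ p = 1 := by
  have hnt := nontrivial_of_ucs p G
  let P : Subgroup G :=
    { carrier := {a | (∀ g, a * g = g * a) ∧ a ^ p = 1}
      one_mem' := ⟨fun g => by simp, one_pow p⟩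
      mul_mem' := fun {a b} ha hb => by
        refine ⟨fun g => ?_, ?_⟩
        · rw [mul_assoc, hb.1, ← mul_assoc, ha.1, mul_assoc]
        · rw [(show Commute a b from ha.1 b).mul_pow, ha.2, hb.2, one_mul]
      inv_mem' := fun {a} ha => by
        refine ⟨fun g => ?_, ?_⟩
        · exact (show Commute a g from ha.1 g).inv_left
        · rw [inv_pow, ha.2, inv_one] }
  have hchar : P.Characteristic := by
    rw [Subgroup.characteristic_iff_le_comap]
    intro f a ha
    refine ⟨fun g => ?_, ?_⟩
    · have := congrArg f (ha.1 (f.symm g))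
      simpa using this
    · have := congrArg f ha.2
      simpa using this
  have hne : P ≠ ⊥ := by
    have hG := IsUCSPSq.isPGroup (p := p) (G := G)
    have hC := hG.center_nontrivial
    obtain ⟨n, hn0, hcard⟩ := (hG.to_subgroup (Subgroup.center G)).nontrivial_iff_card.mp hC
    obtain ⟨a, ha⟩ := exists_prime_orderOf_dvd_card' (G := Subgroup.center G) p
      (hcard ▸ dvd_pow_self p hn0.ne')
    intro h
    have hmem : (a : G) ∈ P := by
      refine ⟨fun g => (Subgroup.mem_center_iff.1 a.2 g).symm, ?_⟩
      rw [← ha]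
      exact_mod_cast congrArg Subtype.val (pow_orderOf_eq_one a)
    rw [h, Subgroup.mem_bot] at hmem
    rw [show a = 1 from Subtype.ext hmem, orderOf_one] at ha
    exact (Fact.out : p.Prime).one_lt.ne ha
  exact (frattini_le_of_char p G P hchar hne hz).2

theorem mul_pow_p
    (p : ℕ) [Fact p.Prime] [Fact (p ≠ 2)] (G : Type u) [Group G] [Finite G] [IsUCSPSq p G]
    (x y : G) : (x * y) ^ p = x ^ p * y ^ p := by
  have hc : y⁻¹ * x⁻¹ * y * x ∈ frattini G := comm_mem_frattini (IsUCSPSq.isPGroup (p := p)) y x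
  have h := mul_pow_of_central (x := x) (y := y) (central_of_mem_frattini p G hc) (by group) p
  obtain ⟨m, hm⟩ := (Fact.out : p.Prime).even_sub_one Fact.out
  have e : p * (p - 1) / 2 = p * m := by
    rw [hm, ← two_mul, mul_left_comm]
    simp
  rw [h, e, pow_mul, pow_eq_one_of_mem_frattini p G hc, one_pow, mul_one]

/-- The `p`-th power map of `G`, as a homomorphism into `Φ(G)`. -/
def powHom
    (p : ℕ) [Fact p.Prime] [Fact (p ≠ 2)] (G : Type u) [Group G] [Finite G] [IsUCSPSq p G]
    : G →* frattini G where
  toFun x := ⟨x ^ p, pow_mem_frattini (IsUCSPSq.isPGroup (p := p)) x⟩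
  map_one' := Subtype.ext (one_pow p)
  map_mul' x y := Subtype.ext (mul_pow_p p G x y)

theorem powHom_ker
    (p : ℕ) [Fact p.Prime] [Fact (p ≠ 2)] (G : Type u) [Group G] [Finite G] [IsUCSPSq p G]
    : (powHom p G).ker = frattini G := by
  have hchar : (powHom p G).ker.Characteristic := by
    rw [Subgroup.characteristic_iff_le_comap]
    intro f a ha
    have ha' : a ^ p = 1 := congrArg Subtype.val (MonoidHom.mem_ker.1 ha)
    have := congrArg f ha'
    exact MonoidHom.mem_ker.2 (Subtype.ext (by simpa [powHom] using this))
  have hle : frattini G ≤ (powHom p G).ker := fun z hz =>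
    MonoidHom.mem_ker.2 (Subtype.ext (pow_eq_one_of_mem_frattini p G hz))
  rcases char_cases p G _ hchar with h | h | h
  · exact absurd (le_bot_iff.1 (h ▸ hle)) (frattini_ne_bot p G)
  · exact h
  · obtain ⟨x, hx⟩ := exists_pow_ne_one p G
    have : x ∈ (powHom p G).ker := h ▸ Subgroup.mem_top x
    exact absurd (congrArg Subtype.val (MonoidHom.mem_ker.1 this)) hx

theorem powHom_surjective
    (p : ℕ) [Fact p.Prime] [Fact (p ≠ 2)] (G : Type u) [Group G] [Finite G] [IsUCSPSq p G]
    : Function.Surjective (powHom p G) := by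
  let R : Subgroup G := (powHom p G).range.map (frattini G).subtype
  have hR : ∀ z, z ∈ R ↔ ∃ x : G, x ^ p = z := by
    intro z
    constructor
    · rintro ⟨_, ⟨x, rfl⟩, rfl⟩
      exact ⟨x, rfl⟩
    · rintro ⟨x, rfl⟩
      exact ⟨_, ⟨x, rfl⟩, rfl⟩
  have hchar : R.Characteristic := by
    rw [Subgroup.characteristic_iff_le_comap]
    intro f a ha
    obtain ⟨x, rfl⟩ := (hR a).1 ha
    exact (hR _).2 ⟨f x, by simp⟩
  have hne : R ≠ ⊥ := by
    obtain ⟨x, hx⟩ := exists_pow_ne_one p G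
    intro h
    have : x ^ p ∈ R := (hR _).2 ⟨x, rfl⟩
    rw [h, Subgroup.mem_bot] at this
    exact hx this
  rintro ⟨z, hz⟩
  obtain ⟨x, hx⟩ := (hR z).1 (frattini_le_of_char p G R hchar hne hz)
  exact ⟨x, Subtype.ext hx⟩

/-- The isomorphism `G / Φ(G) ≃ Φ(G)` that sends the class of `x` to `x ^ p`. -/
noncomputable def powEquiv
    (p : ℕ) [Fact p.Prime] [Fact (p ≠ 2)] (G : Type u) [Group G] [Finite G] [IsUCSPSq p G]
    : G ⧸ frattini G ≃* frattini G :=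
  (QuotientGroup.quotientMulEquivOfEq (powHom_ker p G).symm).trans
    (QuotientGroup.quotientKerEquivOfSurjective _ (powHom_surjective p G))

theorem powEquiv_mk
    (p : ℕ) [Fact p.Prime] [Fact (p ≠ 2)] (G : Type u) [Group G] [Finite G] [IsUCSPSq p G]
    (x : G) : ((powEquiv p G (x : G ⧸ frattini G) : frattini G) : G) = x ^ p := rfl

/-- The commutator `[x, y] = x⁻¹ y⁻¹ x y`, as an element of `Φ(G)`. -/
def comm
    (p : ℕ) [Fact p.Prime] [Fact (p ≠ 2)] (G : Type u) [Group G] [Finite G] [IsUCSPSq p G]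
    (x y : G) : frattini G :=
  ⟨x⁻¹ * y⁻¹ * x * y, comm_mem_frattini (IsUCSPSq.isPGroup (p := p)) x y⟩

theorem comm_mul_right
    (p : ℕ) [Fact p.Prime] [Fact (p ≠ 2)] (G : Type u) [Group G] [Finite G] [IsUCSPSq p G]
    (x y z : G) : comm p G x (y * z) = comm p G x y * comm p G x z := by
  have hc := central_of_mem_frattini p G (comm p G x y).2
  apply Subtype.ext
  calc x⁻¹ * (y * z)⁻¹ * x * (y * z)
      = x⁻¹ * z⁻¹ * x * (x⁻¹ * y⁻¹ * x * y) * z := by group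
    _ = (comm p G x y : G) * (x⁻¹ * z⁻¹ * x) * z := by rw [hc]; rfl
    _ = _ := by
      change _ = (comm p G x y : G) * (x⁻¹ * z⁻¹ * x * z)
      group

theorem comm_mul_left
    (p : ℕ) [Fact p.Prime] [Fact (p ≠ 2)] (G : Type u) [Group G] [Finite G] [IsUCSPSq p G]
    (x y z : G) : comm p G (x * y) z = comm p G x z * comm p G y z := by
  have hc := central_of_mem_frattini p G (comm p G x z).2
  apply Subtype.ext
  calc (x * y)⁻¹ * z⁻¹ * (x * y) * z
      = y⁻¹ * (x⁻¹ * z⁻¹ * x * z) * (z⁻¹ * y * z) := by group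
    _ = (comm p G x z : G) * y⁻¹ * (z⁻¹ * y * z) := by rw [hc]; rfl
    _ = _ := by
      change _ = (comm p G x z : G) * (y⁻¹ * z⁻¹ * y * z)
      group

theorem comm_eq_one_of_mem_left
    (p : ℕ) [Fact p.Prime] [Fact (p ≠ 2)] (G : Type u) [Group G] [Finite G] [IsUCSPSq p G]
    {x : G} (hx : x ∈ frattini G) (y : G) : comm p G x y = 1 := by
  apply Subtype.ext
  change x⁻¹ * y⁻¹ * x * y = 1
  rw [mul_assoc, central_of_mem_frattini p G hx y]
  group

theorem comm_eq_one_of_mem_right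
    (p : ℕ) [Fact p.Prime] [Fact (p ≠ 2)] (G : Type u) [Group G] [Finite G] [IsUCSPSq p G]
    (x : G) {y : G} (hy : y ∈ frattini G) : comm p G x y = 1 := by
  apply Subtype.ext
  change x⁻¹ * y⁻¹ * x * y = 1
  rw [mul_assoc, ← central_of_mem_frattini p G hy x]
  group

theorem comm_congr
    (p : ℕ) [Fact p.Prime] [Fact (p ≠ 2)] (G : Type u) [Group G] [Finite G] [IsUCSPSq p G]
    (x y x' y' : G) (hx : QuotientGroup.leftRel (frattini G) x x')
    (hy : QuotientGroup.leftRel (frattini G) y y') : comm p G x y = comm p G x' y' := by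
  rw [QuotientGroup.leftRel_apply] at hx hy
  rw [show x' = x * (x⁻¹ * x') by group, show y' = y * (y⁻¹ * y') by group,
    comm_mul_left, comm_mul_right, comm_eq_one_of_mem_left p G hx,
    comm_eq_one_of_mem_right p G x hy, mul_one, mul_one]

end Facts

/-! ### The algebra of a UCS group -/

section AlgebraOfGroup

/-- The underlying set of the algebra `L(G)`: the group `G / Φ(G)`, written additively. -/
def LAlg (_p : ℕ) (G : Type u) [Group G] : Type u :=
  Additive (G ⧸ frattini G)

/-- The class of `g : G` in `L(G) = G / Φ(G)`. -/
def LAlg.mk (p : ℕ) {G : Type u} [Group G] (g : G) : LAlg p G :=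
  Additive.ofMul (g : G ⧸ frattini G)

theorem LAlg.ind {p : ℕ} {G : Type u} [Group G] {P : LAlg p G → Prop}
    (h : ∀ g : G, P (LAlg.mk p g)) (x : LAlg p G) : P x :=
  QuotientGroup.induction_on (C := P) x h

/-- The addition of `L(G)` is the operation induced by the multiplication of `G`. -/
instance (p : ℕ) (G : Type u) [Group G] : AddGroup (LAlg p G) :=
  inferInstanceAs (AddGroup (Additive (G ⧸ frattini G)))

instance (p : ℕ) (G : Type u) [Group G] [Finite G] : Finite (LAlg p G) :=
  inferInstanceAs (Finite (G ⧸ frattini G))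

variable (p : ℕ) [Fact p.Prime] [Fact (p ≠ 2)] (G : Type u) [Group G] [Finite G] [IsUCSPSq p G]

instance : AddCommGroup (LAlg p G) :=
  { (inferInstance : AddGroup (LAlg p G)) with
    add_comm := by
      intro x y
      induction x using LAlg.ind with | _ x
      induction y using LAlg.ind with | _ y
      refine congrArg Additive.ofMul (QuotientGroup.eq.2 ?_ : ((x * y : G) : G ⧸ frattini G) = _)
      have := comm_mem_frattini (IsUCSPSq.isPGroup (p := p)) y x
      rwa [show (x * y)⁻¹ * (y * x) = y⁻¹ * x⁻¹ * y * x by group] }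

/-- `p`-th roots: for `h ∈ Φ(G)`, the unique element `x Φ(G)` of `L(G)` with `x ^ p = h`. -/
noncomputable def root (h : frattini G) : LAlg p G :=
  Additive.ofMul ((powEquiv p G).symm h)

theorem root_eq_mk_iff (h : frattini G) (x : G) :
    root p G h = LAlg.mk p x ↔ x ^ p = (h : G) := by
  change (powEquiv p G).symm h = (x : G ⧸ frattini G) ↔ _
  rw [MulEquiv.symm_apply_eq, Subtype.ext_iff, powEquiv_mk]
  exact eq_comm

theorem root_mul (h k : frattini G) : root p G (h * k) = root p G h + root p G k :=
  congrArg Additive.ofMul (map_mul (powEquiv p G).symm h k)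

theorem root_one : root p G 1 = 0 :=
  congrArg Additive.ofMul (map_one (powEquiv p G).symm)

/-- The product of `L(G)`: the product of the classes of `x` and `y` is `[x, y] ^ (1 / p)`. -/
noncomputable instance : Mul (LAlg p G) where
  mul x y := root p G (Quotient.liftOn₂ x y (comm p G) (comm_congr p G))

theorem LAlg.mk_mul_mk (x y : G) :
    LAlg.mk p x * LAlg.mk p y = root p G (comm p G x y) := rfl

theorem LAlg.mk_add_mk (x y : G) : LAlg.mk p x + LAlg.mk p y = LAlg.mk p (x * y) := rfl

noncomputable instance : NonUnitalNonAssocRing (LAlg p G) where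
  left_distrib := by
    intro x y z
    induction x using LAlg.ind with | _ x
    induction y using LAlg.ind with | _ y
    induction z using LAlg.ind with | _ z
    rw [LAlg.mk_add_mk, LAlg.mk_mul_mk, comm_mul_right, root_mul]
    rfl
  right_distrib := by
    intro x y z
    induction x using LAlg.ind with | _ x
    induction y using LAlg.ind with | _ y
    induction z using LAlg.ind with | _ z
    rw [LAlg.mk_add_mk, LAlg.mk_mul_mk, comm_mul_left, root_mul]
    rfl
  zero_mul := by
    intro x
    induction x using LAlg.ind with | _ x
    change LAlg.mk p (1 : G) * _ = _
    rw [LAlg.mk_mul_mk, comm_eq_one_of_mem_left p G (one_mem _), root_one]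
  mul_zero := by
    intro x
    induction x using LAlg.ind with | _ x
    change _ * LAlg.mk p (1 : G) = _
    rw [LAlg.mk_mul_mk, comm_eq_one_of_mem_right p G x (one_mem _), root_one]

/-- The scalar `λ` acts as the integer between `0` and `p - 1` that represents it. -/
instance : Module (ZMod p) (LAlg p G) :=
  AddCommGroup.zmodModule (n := p) (by
    intro x
    induction x using LAlg.ind with | _ x
    exact congrArg Additive.ofMul ((QuotientGroup.eq_one_iff _).2
      (pow_mem_frattini (IsUCSPSq.isPGroup (p := p)) x) : ((x ^ p : G) : G ⧸ frattini G) = 1))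

instance : SMulCommClass (ZMod p) (LAlg p G) (LAlg p G) where
  smul_comm c x y := (ZMod.map_smul (AddMonoidHom.mulLeft x) c y).symm

instance : IsScalarTower (ZMod p) (LAlg p G) (LAlg p G) where
  smul_assoc c x y := ZMod.map_smul (AddMonoidHom.mulRight y) c x

end AlgebraOfGroup

end UCSIAC

open UCSIAC

namespace UCSIAC

open Function

/-! ### Extensions of an algebra by itself along the `p`-th power map -/

section Extensions

/-! The central notion is `PowerExtension`: a group `G` with maps `proj : G → L` and `emb : L → G`
making it a central extension of `L` by itself, in which `x ^ p = emb (proj x)` and commutators are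
`emb` of products. A UCS group of exponent `p ^ 2` carries one with `L = L(G)`
(`canonicalExtension`). Both maps are tied to the `p`-th power map, so every group isomorphism
respects them and induces an algebra isomorphism (`PowerExtension.exists_map`).

The converse, `PowerExtension.exists_lift`, is the heart of the matter. As `p` is odd, the Baer
trick applies: `x * y * emb (-½ (proj x * proj y))` is a commutative group law on `G` with the same
powers, so `G` becomes an abelian extension of `L` by `L` in which multiplication by `p` is `emb ∘
proj`. Such an abelian group is free over `ℤ/p²`, with a basis lifting any given basis of `L`; hence
linear isomorphisms lift to additive ones. If the linear map also preserves products, its lift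
preserves the correction term and is therefore a group isomorphism. Run backwards, the same formula
turns a free `ℤ/p²`-module over an anti-commutative algebra into a group, which gives surjectivity
on isomorphism classes.

With maps passing in both directions, characteristic subgroups of `G` and `Aut(L)`-invariant
subspaces of `L` control each other: UCS yields IAC (`isIAC_LAlg`) and IAC yields UCS
(`PowerExtension.isUCSPSq`). Lifting also makes `Aut(G) → Aut(L)` surjective; its kernel consists of
the automorphisms `x ↦ x * emb (f (proj x))` with `f` a linear endomorphism of `L`
(`PowerExtension.mem_range_twistHom`), hence its order. Powerful subgroups are handled by pulling
commutators and `p`-th powers back along `emb`. For direct powers it suffices that powers of IAC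
algebras are IAC (`IsIAC.pi`). -/

/-- A group `G` which is an extension of (the additive group of) `L` by itself, such that the
`p`-th power map is the composite of the projection and the embedding, and such that the
commutator map of `G` is given by the product of `L`. -/
structure PowerExtension (p : ℕ) (G L : Type*) [Group G] [NonUnitalNonAssocRing L] where
  proj : G → L
  emb : L → G
  proj_mul : ∀ x y, proj (x * y) = proj x + proj y
  emb_add : ∀ a b, emb (a + b) = emb a * emb b
  proj_surjective : Surjective proj
  emb_injective : Injective emb
  proj_eq_zero_iff : ∀ x, proj x = 0 ↔ ∃ a, emb a = x
  emb_proj : ∀ x, emb (proj x) = x ^ p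
  comm_eq : ∀ x y, x⁻¹ * y⁻¹ * x * y = emb (proj x * proj y)

/-- An abelian group `A` which is an extension of `L` by itself, such that multiplication by `p`
is the composite of the projection and the embedding. -/
structure AddPowerExtension (p : ℕ) (A L : Type*) [AddCommGroup A] [AddCommGroup L] where
  proj : A →+ L
  emb : L →+ A
  proj_surjective : Surjective proj
  emb_injective : Injective emb
  proj_eq_zero_iff : ∀ x, proj x = 0 ↔ ∃ a, emb a = x
  emb_proj : ∀ x, emb (proj x) = p • x

namespace AddPowerExtension

variable {p : ℕ} {A B L M : Type*} [AddCommGroup A] [AddCommGroup B] [AddCommGroup L]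
  [AddCommGroup M]

theorem proj_emb (E : AddPowerExtension p A L) (a : L) : E.proj (E.emb a) = 0 :=
  (E.proj_eq_zero_iff _).2 ⟨a, rfl⟩

/-- Every element of the kernel of `proj` is a multiple `p • x`, so a homomorphism is determined
there by what it induces on the quotient. This is what makes one map `g` serve on both ends of the
extension. -/
theorem map_emb (E : AddPowerExtension p A L) (E' : AddPowerExtension p B M) {f : A →+ B}
    {g : L → M} (h : ∀ x, E'.proj (f x) = g (E.proj x)) (a : L) :
    f (E.emb a) = E'.emb (g a) := by
  obtain ⟨x, rfl⟩ := E.proj_surjective a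
  rw [E.emb_proj, map_nsmul, ← h, E'.emb_proj]

/-- A homomorphism of extensions is bijective if it induces a bijection on the quotients. -/
theorem bijective_of_proj (E : AddPowerExtension p A L) (E' : AddPowerExtension p B M)
    {f : A →+ B} {g : L ≃+ M} (h : ∀ x, E'.proj (f x) = g (E.proj x)) : Bijective f := by
  -- The short five lemma, with `g` on both the sub and the quotient.
  constructor
  · rw [injective_iff_map_eq_zero]
    intro x hx
    have h0 : E.proj x = 0 := by
      have := h x
      rw [hx, map_zero] at this
      exact g.injective (by rw [← this, map_zero])
    obtain ⟨a, rfl⟩ := (E.proj_eq_zero_iff x).1 h0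
    rw [E.map_emb E' h] at hx
    have : g a = 0 := E'.emb_injective (by rw [hx, map_zero])
    rw [g.map_eq_zero_iff.1 this, map_zero]
  · intro y
    obtain ⟨x, hx⟩ := E.proj_surjective (g.symm (E'.proj y))
    have h0 : E'.proj (y - f x) = 0 := by rw [map_sub, h, hx, g.apply_symm_apply, sub_self]
    obtain ⟨b, hb⟩ := (E'.proj_eq_zero_iff _).1 h0
    refine ⟨x + E.emb (g.symm b), ?_⟩
    rw [map_add, E.map_emb E' h, g.apply_symm_apply, hb, add_sub_cancel]

theorem sq_nsmul_eq_zero (E : AddPowerExtension p A L) (x : A) : (p ^ 2) • x = 0 := by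
  rw [sq, mul_nsmul, ← E.emb_proj, ← E.emb_proj, E.proj_emb, map_zero]

end AddPowerExtension

/-! ### The standard extension -/

section Standard

variable (p : ℕ) [Fact p.Prime]

/-- Multiplication by `p`, as a map from `ℤ/p` to `ℤ/p²`. -/
def mulP : ZMod p →+ ZMod (p ^ 2) :=
  ZMod.lift p ⟨zmultiplesHom _ (p : ZMod (p ^ 2)), by
    simp only [zmultiplesHom_apply, natCast_zsmul, nsmul_eq_mul]
    rw [← Nat.cast_mul, ← sq, ZMod.natCast_self]⟩

theorem mulP_natCast (n : ℕ) : mulP p n = ((p * n : ℕ) : ZMod (p ^ 2)) := by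
  have : mulP p ((n : ℤ) : ZMod p) = _ := ZMod.lift_coe _ _ _
  rw [Int.cast_natCast] at this
  rw [this]
  simp [mul_comm]

theorem mulP_injective : Injective (mulP p) := by
  rw [injective_iff_map_eq_zero]
  intro x hx
  rw [← ZMod.natCast_zmod_val x] at hx ⊢
  rw [mulP_natCast, ZMod.natCast_eq_zero_iff, sq] at hx
  exact (ZMod.natCast_eq_zero_iff _ _).2
    (Nat.dvd_of_mul_dvd_mul_left (Fact.out : p.Prime).pos hx)

/-- Reduction modulo `p`. -/
def redP : ZMod (p ^ 2) →+* ZMod p := ZMod.castHom (dvd_pow_self p two_ne_zero) (ZMod p)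

theorem redP_surjective : Surjective (redP p) :=
  ZMod.castHom_surjective _

theorem redP_eq_zero_iff (x : ZMod (p ^ 2)) : redP p x = 0 ↔ ∃ a, mulP p a = x := by
  have hp : 0 < p := (Fact.out : p.Prime).pos
  have : NeZero (p ^ 2) := ⟨(pow_pos hp 2).ne'⟩
  constructor
  · intro h
    rw [← ZMod.natCast_zmod_val x, map_natCast, ZMod.natCast_eq_zero_iff] at h
    obtain ⟨m, hm⟩ := h
    exact ⟨m, by rw [mulP_natCast, ← hm, ZMod.natCast_zmod_val]⟩
  · rintro ⟨a, rfl⟩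
    rw [← ZMod.natCast_zmod_val a, mulP_natCast, map_natCast, ZMod.natCast_eq_zero_iff]
    exact dvd_mul_right _ _

theorem mulP_redP (x : ZMod (p ^ 2)) : mulP p (redP p x) = p • x := by
  have : NeZero (p ^ 2) := ⟨(pow_pos (Fact.out : p.Prime).pos 2).ne'⟩
  rw [← ZMod.natCast_zmod_val x, map_natCast, mulP_natCast]
  simp

variable {p} {L : Type*} [AddCommGroup L] [Module (ZMod p) L] {ι : Type*} [Fintype ι]

/-- The free `ℤ/p²`-module on a basis of `L`, as an extension of `L` by itself. -/
noncomputable def stdExtension (b : Module.Basis ι (ZMod p) L) :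
    AddPowerExtension p (ι → ZMod (p ^ 2)) L where
  proj := (b.equivFun.symm : (ι → ZMod p) →+ L).comp
    ((redP p : ZMod (p ^ 2) →+ ZMod p).compLeft ι)
  emb := ((mulP p).compLeft ι).comp (b.equivFun : L →+ (ι → ZMod p))
  proj_surjective := b.equivFun.symm.surjective.comp (redP_surjective p).comp_left
  emb_injective := ((mulP_injective p).comp_left).comp b.equivFun.injective
  proj_eq_zero_iff x := by
    change b.equivFun.symm (fun j => redP p (x j)) = 0 ↔
      ∃ a, (fun j => mulP p (b.equivFun a j)) = x
    rw [LinearEquiv.map_eq_zero_iff]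
    constructor
    · intro h
      choose a ha using fun j => (redP_eq_zero_iff p (x j)).1 (congrFun h j)
      exact ⟨b.equivFun.symm a, funext fun j => by rw [LinearEquiv.apply_symm_apply, ha]⟩
    · rintro ⟨a, rfl⟩
      exact funext fun j => (redP_eq_zero_iff p _).2 ⟨_, rfl⟩
  emb_proj x := by
    change (fun j => mulP p (b.equivFun (b.equivFun.symm (fun j => redP p (x j))) j)) = p • x
    rw [LinearEquiv.apply_symm_apply]
    exact funext fun j => mulP_redP p (x j)

theorem stdExtension_proj_apply (b : Module.Basis ι (ZMod p) L) (x : ι → ZMod (p ^ 2)) :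
    (stdExtension b).proj x = ∑ j, redP p (x j) • b j :=
  b.equivFun_symm_apply _

/-- Every extension of `L` is isomorphic to the standard one. -/
theorem AddPowerExtension.exists_stdEquiv {A : Type*} [AddCommGroup A]
    (E : AddPowerExtension p A L) (b : Module.Basis ι (ZMod p) L) :
    ∃ e : (ι → ZMod (p ^ 2)) ≃+ A, ∀ x, E.proj (e x) = (stdExtension b).proj x := by
  have : NeZero (p ^ 2) := ⟨(pow_pos (Fact.out : p.Prime).pos 2).ne'⟩
  let _ : Module (ZMod (p ^ 2)) A := AddCommGroup.zmodModule E.sq_nsmul_eq_zero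
  -- Arbitrary lifts of the basis define a `ℤ/p²`-linear map from the free module that covers the
  -- identity of `L`, hence is bijective.
  choose g hg using fun j => E.proj_surjective (b j)
  let f : (ι → ZMod (p ^ 2)) →+ A := (Fintype.linearCombination (ZMod (p ^ 2)) g).toAddMonoidHom
  have hf : ∀ x, E.proj (f x) = AddEquiv.refl L ((stdExtension b).proj x) := by
    intro x
    change E.proj (∑ j, x j • g j) = (stdExtension b).proj x
    rw [stdExtension_proj_apply, map_sum]
    refine Finset.sum_congr rfl fun j _ => ?_
    rw [← hg, ← ZMod.natCast_zmod_val (x j), map_natCast, Nat.cast_smul_eq_nsmul,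
      Nat.cast_smul_eq_nsmul, map_nsmul]
  exact ⟨AddEquiv.ofBijective f ((stdExtension b).bijective_of_proj E hf), hf⟩

/-- Linear isomorphisms lift to extensions. -/
theorem AddPowerExtension.exists_lift [Module.Finite (ZMod p) L] {A B M : Type*}
    [AddCommGroup A] [AddCommGroup B] [AddCommGroup M] [Module (ZMod p) M]
    (E : AddPowerExtension p A L) (E' : AddPowerExtension p B M) (f : L ≃ₗ[ZMod p] M) :
    ∃ e : A ≃+ B, ∀ x, E'.proj (e x) = f (E.proj x) := by
  -- With the bases `b` and `b.map f`, both extensions are compared with one coordinate model, in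
  -- which `f` is the identity on coordinates.
  let b := Module.finBasis (ZMod p) L
  obtain ⟨e, he⟩ := E.exists_stdEquiv b
  obtain ⟨e', he'⟩ := E'.exists_stdEquiv (b.map f)
  refine ⟨e.symm.trans e', fun x => ?_⟩
  obtain ⟨y, rfl⟩ := e.surjective x
  rw [AddEquiv.trans_apply, e.symm_apply_apply, he', he, stdExtension_proj_apply,
    stdExtension_proj_apply, map_sum]
  simp

end Standard

end Extensions

/-! ### The Baer correspondence -/

section Baer

theorem two_ne_zero_zmod (p : ℕ) [Fact p.Prime] [Fact (p ≠ 2)] : (2 : ZMod p) ≠ 0 :=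
  ZMod.prime_ne_zero p 2 Fact.out

/-- Half of the product. -/
def halfMul (p : ℕ) {L : Type*} [NonUnitalNonAssocRing L] [Fact p.Prime] [Module (ZMod p) L]
    (x y : L) : L :=
  (2 : ZMod p)⁻¹ • (x * y)

section halfMul

variable (p : ℕ) [Fact p.Prime] {L : Type*} [NonUnitalNonAssocRing L] [Module (ZMod p) L]

theorem halfMul_add_left (x y z : L) : halfMul p (x + y) z = halfMul p x z + halfMul p y z := by
  rw [halfMul, add_mul, smul_add]; rfl

theorem halfMul_add_right (x y z : L) : halfMul p x (y + z) = halfMul p x y + halfMul p x z := by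
  rw [halfMul, mul_add, smul_add]; rfl

theorem halfMul_zero_left (x : L) : halfMul p 0 x = 0 := by
  rw [halfMul, zero_mul, smul_zero]

theorem halfMul_zero_right (x : L) : halfMul p x 0 = 0 := by
  rw [halfMul, mul_zero, smul_zero]

theorem halfMul_self (h : ∀ x : L, x * x = 0) (x : L) : halfMul p x x = 0 := by
  rw [halfMul, h, smul_zero]

theorem halfMul_neg_left (x y : L) : halfMul p (-x) y = -halfMul p x y := by
  rw [halfMul, neg_mul, smul_neg]; rfl

theorem halfMul_swap (h : ∀ x : L, x * x = 0) (x y : L) : halfMul p y x = -halfMul p x y := by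
  have := halfMul_self p h (x + y)
  rw [halfMul_add_left, halfMul_add_right, halfMul_add_right, halfMul_self p h,
    halfMul_self p h, zero_add, add_zero] at this
  exact (neg_eq_of_add_eq_zero_right this).symm

theorem halfMul_add_self [Fact (p ≠ 2)] (x y : L) : halfMul p x y + halfMul p x y = x * y := by
  rw [halfMul, ← add_smul, ← two_mul, mul_inv_cancel₀ (two_ne_zero_zmod p), one_smul]

/-- The correction term vanishes between a power of `x` and `x`, so the Baer correspondence leaves
powers unchanged in either direction. -/
theorem halfMul_nsmul_left_self (h : ∀ x : L, x * x = 0) (n : ℕ) (x : L) :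
    halfMul p (n • x) x = 0 := by
  induction n with
  | zero => rw [zero_nsmul, halfMul_zero_left]
  | succ n ih => rw [succ_nsmul, halfMul_add_left, ih, halfMul_self p h, add_zero]

theorem map_halfMul {M : Type*} [NonUnitalNonAssocRing M] [Module (ZMod p) M]
    (f : L ≃ₗ[ZMod p] M) (hf : ∀ x y, f (x * y) = f x * f y) (x y : L) :
    f (halfMul p x y) = halfMul p (f x) (f y) := by
  rw [halfMul, map_smul, hf]; rfl

end halfMul

/-! ### From group extensions to abelian extensions -/

namespace PowerExtension

variable {p : ℕ} {G L : Type*} [Group G] [NonUnitalNonAssocRing L] (D : PowerExtension p G L)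

/-- The projection, as a homomorphism. -/
def projHom : G →* Multiplicative L :=
  MonoidHom.mk' (fun x => Multiplicative.ofAdd (D.proj x)) D.proj_mul

/-- The embedding, as a homomorphism. -/
def embHom : Multiplicative L →* G :=
  MonoidHom.mk' (fun x => D.emb x.toAdd) fun _ _ => D.emb_add _ _

theorem proj_one : D.proj 1 = 0 := map_one D.projHom

theorem proj_inv (x : G) : D.proj x⁻¹ = -D.proj x := map_inv D.projHom x

theorem proj_pow (x : G) (n : ℕ) : D.proj (x ^ n) = n • D.proj x := map_pow D.projHom x n

theorem emb_zero : D.emb 0 = 1 := map_one D.embHom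

theorem proj_emb (a : L) : D.proj (D.emb a) = 0 := (D.proj_eq_zero_iff _).2 ⟨a, rfl⟩

theorem emb_eq_one_iff (a : L) : D.emb a = 1 ↔ a = 0 := by
  rw [← D.emb_zero, D.emb_injective.eq_iff]

theorem mul_comm_emb (x y : G) : x * y = y * x * D.emb (D.proj x * D.proj y) := by
  rw [← D.comm_eq]; group

theorem emb_comm (a : L) (x : G) : D.emb a * x = x * D.emb a := by
  rw [D.mul_comm_emb, proj_emb, zero_mul, emb_zero, mul_one]

/-- An element commutes with itself. -/
theorem mul_self (D : PowerExtension p G L) (a : L) : a * a = 0 := by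
  obtain ⟨x, rfl⟩ := D.proj_surjective a
  rw [← D.emb_eq_one_iff, ← D.comm_eq]
  group

variable [Fact p.Prime] [Module (ZMod p) L]

/-- The Baer sum. -/
def baerAdd (x y : G) : G := x * y * D.emb (-halfMul p (D.proj x) (D.proj y))

theorem proj_baerAdd (x y : G) : D.proj (D.baerAdd x y) = D.proj x + D.proj y := by
  rw [baerAdd, proj_mul, proj_mul, proj_emb, add_zero]

theorem mul_eq_baerAdd (x y : G) :
    x * y = D.baerAdd x y * D.emb (halfMul p (D.proj x) (D.proj y)) := by
  rw [baerAdd, mul_assoc, ← emb_add, neg_add_cancel, emb_zero, mul_one]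

theorem baerAdd_emb (x : G) (a : L) : D.baerAdd x (D.emb a) = x * D.emb a := by
  rw [baerAdd, proj_emb, halfMul_zero_right, neg_zero, emb_zero, mul_one]

theorem pow_succ_baer (n : ℕ) (x : G) : x ^ (n + 1) = D.baerAdd (x ^ n) x := by
  rw [baerAdd, proj_pow, halfMul_nsmul_left_self p D.mul_self, neg_zero, emb_zero, mul_one,
    pow_succ]

/-- The abelian group with the Baer sum as operation. -/
abbrev baerGroup [Fact (p ≠ 2)] : AddCommGroup G where
  add x y := D.baerAdd x y
  zero := 1
  neg x := x⁻¹
  add_assoc x y z := by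
    change D.baerAdd (D.baerAdd x y) z = D.baerAdd x (D.baerAdd y z)
    have hz := D.emb_comm (-halfMul p (D.proj x) (D.proj y)) z
    calc D.baerAdd (D.baerAdd x y) z
        = x * y * (D.emb (-halfMul p (D.proj x) (D.proj y)) * z) *
            D.emb (-halfMul p (D.proj x + D.proj y) (D.proj z)) := by
          rw [baerAdd, proj_baerAdd, baerAdd, mul_assoc (x * y)]
      _ = x * y * z * D.emb (-halfMul p (D.proj x) (D.proj y) +
            -halfMul p (D.proj x + D.proj y) (D.proj z)) := by
          rw [hz, emb_add]
          simp only [mul_assoc]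
      -- By biadditivity both corrections are minus half the sum of the three products taken in the
      -- order of `x`, `y`, `z`; associativity in `L` plays no role.
      _ = x * y * z * D.emb (-halfMul p (D.proj y) (D.proj z) +
            -halfMul p (D.proj x) (D.proj y + D.proj z)) := by
          rw [halfMul_add_left, halfMul_add_right]
          congr 2
          abel
      _ = D.baerAdd x (D.baerAdd y z) := by
          rw [baerAdd, proj_baerAdd, baerAdd, emb_add]
          simp only [mul_assoc]
  zero_add x := by
    change D.baerAdd 1 x = x
    rw [baerAdd, proj_one, halfMul_zero_left, neg_zero, emb_zero, mul_one, one_mul]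
  add_zero x := by
    change D.baerAdd x 1 = x
    rw [baerAdd, proj_one, halfMul_zero_right, neg_zero, emb_zero, mul_one, mul_one]
  neg_add_cancel x := by
    change D.baerAdd x⁻¹ x = 1
    rw [baerAdd, proj_inv, halfMul_neg_left, halfMul_self p D.mul_self, neg_zero, neg_zero,
      emb_zero, mul_one, inv_mul_cancel]
  add_comm x y := by
    change D.baerAdd x y = D.baerAdd y x
    -- Writing `a`, `b` for the projections: passing from `x * y` to `y * x` costs `a * b`, and `a *
    -- b - ½ (a * b) = ½ (a * b) = -½ (b * a)`.
    rw [baerAdd, baerAdd, D.mul_comm_emb x y, mul_assoc, ← emb_add,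
      halfMul_swap p D.mul_self (D.proj x) (D.proj y),
      ← halfMul_add_self p, add_neg_cancel_right, neg_neg]
  -- With this choice `p • x` is `x ^ p` by definition, so `emb_proj` carries over verbatim in
  -- `baer`.
  nsmul n x := x ^ n
  nsmul_zero := pow_zero
  nsmul_succ := D.pow_succ_baer
  zsmul := @zsmulRec _ ⟨1⟩ ⟨D.baerAdd⟩ ⟨fun x => x⁻¹⟩ fun n x => x ^ n
  zsmul_zero' := pow_zero
  zsmul_succ' := D.pow_succ_baer

/-- The extension of abelian groups that corresponds to an extension of groups. -/
def baer [Fact (p ≠ 2)] : @AddPowerExtension p G L D.baerGroup _ :=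
  letI := D.baerGroup
  { proj := AddMonoidHom.mk' D.proj D.proj_baerAdd
    emb := AddMonoidHom.mk' D.emb fun a b => by
      change _ = D.baerAdd (D.emb a) (D.emb b)
      rw [baerAdd_emb, emb_add]
    proj_surjective := D.proj_surjective
    emb_injective := D.emb_injective
    proj_eq_zero_iff := D.proj_eq_zero_iff
    emb_proj := D.emb_proj }

/-- Isomorphisms of algebras lift to extensions. -/
theorem exists_lift [Fact (p ≠ 2)] [Module.Finite (ZMod p) L] {H M : Type*} [Group H]
    [NonUnitalNonAssocRing M] [Module (ZMod p) M] (D' : PowerExtension p H M)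
    (f : L ≃ₗ[ZMod p] M) (hf : ∀ x y, f (x * y) = f x * f y) :
    ∃ e : G ≃* H, ∀ x, D'.proj (e x) = f (D.proj x) := by
  let _ := D.baerGroup
  let _ := D'.baerGroup
  obtain ⟨e, he⟩ := D.baer.exists_lift D'.baer f
  replace he : ∀ x, D'.proj (e x) = f (D.proj x) := he
  have hemb : ∀ a, e (D.emb a) = D'.emb (f a) :=
    D.baer.map_emb D'.baer (f := (e : G →+ H)) (g := f) he
  have hadd : ∀ x y, e (D.baerAdd x y) = D'.baerAdd (e x) (e y) := map_add e
  refine ⟨{ e.toEquiv with map_mul' := fun x y => ?_ }, he⟩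
  change e (x * y) = e x * e y
  -- The group product is the Baer sum of `x`, `y` and the embedded half product; `e` is additive
  -- and respects each term.
  rw [D.mul_eq_baerAdd, ← baerAdd_emb, hadd, hadd, hemb, baerAdd_emb,
    D'.mul_eq_baerAdd (e x), he, he, map_halfMul p f hf]

end PowerExtension

/-! ### From abelian extensions back to groups -/

namespace AddPowerExtension

variable {p : ℕ} [Fact p.Prime] {A L : Type*} [AddCommGroup A]
  [NonUnitalNonAssocRing L] [Module (ZMod p) L]

variable (E : AddPowerExtension p A L) (h : ∀ x : L, x * x = 0)

/-- The group operation given by the Baer correspondence. -/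
def grpMul (x y : A) : A := x + y + E.emb (halfMul p (E.proj x) (E.proj y))

theorem proj_grpMul (x y : A) : E.proj (E.grpMul x y) = E.proj x + E.proj y := by
  rw [grpMul, map_add, map_add, proj_emb, add_zero]

theorem grpMul_emb (x : A) (a : L) : E.grpMul x (E.emb a) = x + E.emb a := by
  rw [grpMul, proj_emb, halfMul_zero_right, map_zero, add_zero]

theorem succ_nsmul_grpMul (h : ∀ x : L, x * x = 0) (n : ℕ) (x : A) :
    (n + 1) • x = E.grpMul (n • x) x := by
  rw [grpMul, map_nsmul, halfMul_nsmul_left_self p h, map_zero, add_zero, succ_nsmul]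

/-- The group that corresponds to an extension of abelian groups, on the same underlying set. -/
abbrev group : Group A where
  mul x y := E.grpMul x y
  one := 0
  inv x := -x
  mul_assoc x y z := by
    change E.grpMul (E.grpMul x y) z = E.grpMul x (E.grpMul y z)
    rw [grpMul, proj_grpMul, grpMul, grpMul, proj_grpMul, grpMul, halfMul_add_left,
      halfMul_add_right, map_add, map_add]
    abel
  one_mul x := by
    change E.grpMul 0 x = x
    rw [grpMul, map_zero, halfMul_zero_left, map_zero, add_zero, zero_add]
  mul_one x := by
    change E.grpMul x 0 = x
    rw [grpMul, map_zero, halfMul_zero_right, map_zero, add_zero, add_zero]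
  inv_mul_cancel x := by
    change E.grpMul (-x) x = 0
    rw [grpMul, map_neg, halfMul_neg_left, halfMul_self p h, neg_zero, map_zero, add_zero,
      neg_add_cancel]
  npow n x := n • x
  npow_zero := zero_nsmul
  npow_succ := E.succ_nsmul_grpMul h
  zpow := @zpowRec _ ⟨0⟩ ⟨E.grpMul⟩ ⟨fun x => -x⟩ fun n x => n • x
  zpow_zero' := zero_nsmul
  zpow_succ' := E.succ_nsmul_grpMul h

/-- The extension of groups that corresponds to an extension of abelian groups. -/
def toPowerExtension [Fact (p ≠ 2)] : @PowerExtension p A L (E.group h) _ :=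
  letI := E.group h
  { proj := E.proj
    emb := E.emb
    proj_mul := E.proj_grpMul
    emb_add := fun a b => by
      change _ = E.grpMul (E.emb a) (E.emb b)
      rw [grpMul_emb, map_add]
    proj_surjective := E.proj_surjective
    emb_injective := E.emb_injective
    proj_eq_zero_iff := E.proj_eq_zero_iff
    emb_proj := E.emb_proj
    comm_eq := fun x y => by
      have : x * y = y * x * E.emb (E.proj x * E.proj y) := by
        change E.grpMul x y = E.grpMul (E.grpMul y x) (E.emb _)
        rw [grpMul_emb, grpMul, grpMul, halfMul_swap p h (E.proj x) (E.proj y),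
          ← halfMul_add_self p, map_add, map_neg]
        abel
      rw [mul_assoc, this, ← mul_inv_rev, inv_mul_cancel_left] }

end AddPowerExtension

end Baer

/-! ### Group isomorphisms, algebra isomorphisms and characteristic subgroups -/

section UCS

namespace PowerExtension

variable {p : ℕ} {G L : Type*} [Group G] [NonUnitalNonAssocRing L] (D : PowerExtension p G L)

/-- The fibres of `proj` are described by the power map alone, so every group isomorphism respects
them. -/
theorem proj_eq_proj_iff (x y : G) : D.proj x = D.proj y ↔ x ^ p = y ^ p := by
  rw [← D.emb_proj, ← D.emb_proj, D.emb_injective.eq_iff]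

theorem proj_eq_zero_iff_pow (x : G) : D.proj x = 0 ↔ x ^ p = 1 := by
  rw [← D.proj_one, proj_eq_proj_iff, one_pow]

theorem pow_sq_eq_one (D : PowerExtension p G L) (x : G) : x ^ p ^ 2 = 1 := by
  rw [sq, pow_mul, ← D.proj_eq_zero_iff_pow, ← D.emb_proj, D.proj_emb]

variable [Module (ZMod p) L]

/-- Isomorphisms of extensions induce isomorphisms of the algebras. -/
theorem exists_map {H M : Type*} [Group H] [NonUnitalNonAssocRing M] [Module (ZMod p) M]
    (D' : PowerExtension p H M) (e : G ≃* H) :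
    ∃ f : L ≃ₗ[ZMod p] M, (∀ a b, f (a * b) = f a * f b) ∧
      ∀ x, D'.proj (e x) = f (D.proj x) := by
  have key : ∀ x y, D'.proj (e x) = D'.proj (e y) ↔ D.proj x = D.proj y := by
    intro x y
    rw [proj_eq_proj_iff, proj_eq_proj_iff, ← map_pow, ← map_pow, e.injective.eq_iff]
  let φ : L → M := fun a => D'.proj (e (surjInv D.proj_surjective a))
  have hφ : ∀ x, D'.proj (e x) = φ (D.proj x) := fun x =>
    (key _ _).2 (surjInv_eq D.proj_surjective _).symm
  have hadd : ∀ a b, φ (a + b) = φ a + φ b := by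
    intro a b
    obtain ⟨x, rfl⟩ := D.proj_surjective a
    obtain ⟨y, rfl⟩ := D.proj_surjective b
    rw [← proj_mul, ← hφ, ← hφ, ← hφ, map_mul, proj_mul]
  have hbij : Bijective φ := by
    constructor
    · intro a b h
      obtain ⟨x, rfl⟩ := D.proj_surjective a
      obtain ⟨y, rfl⟩ := D.proj_surjective b
      rwa [← hφ, ← hφ, key] at h
    · intro b
      obtain ⟨y, rfl⟩ := D'.proj_surjective b
      exact ⟨D.proj (e.symm y), by rw [← hφ, e.apply_symm_apply]⟩
  have hemb : ∀ a, D'.emb (φ a) = e (D.emb a) := by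
    intro a
    obtain ⟨x, rfl⟩ := D.proj_surjective a
    rw [← hφ, emb_proj, emb_proj, map_pow]
  refine ⟨LinearEquiv.ofBijective ((AddMonoidHom.mk' φ hadd).toZModLinearMap p) hbij, ?_, hφ⟩
  intro a b
  change φ (a * b) = φ a * φ b
  obtain ⟨x, rfl⟩ := D.proj_surjective a
  obtain ⟨y, rfl⟩ := D.proj_surjective b
  rw [← D'.emb_injective.eq_iff, hemb, ← comm_eq, ← hφ, ← hφ, ← comm_eq]
  simp only [map_mul, map_inv]

/-- The image of a subgroup of `G` in `L`. -/
def image (K : Subgroup G) : Submodule (ZMod p) L :=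
  AddSubgroup.toZModSubmodule p (Subgroup.toAddSubgroup' (K.map D.projHom))

theorem mem_image {K : Subgroup G} {a : L} : a ∈ D.image K ↔ ∃ x ∈ K, D.proj x = a := Iff.rfl

/-- A subgroup that covers `L` is the whole group. -/
theorem eq_top_of_image_eq_top {K : Subgroup G} (h : D.image K = ⊤) : K = ⊤ := by
  have h' : ∀ x, ∃ k ∈ K, D.proj k = D.proj x := fun x =>
    D.mem_image.1 (h ▸ Submodule.mem_top)
  refine (Subgroup.eq_top_iff' K).2 fun x => ?_
  obtain ⟨k, hk, hkx⟩ := h' x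
  -- The discrepancy `k⁻¹ * x` lies in the image of `emb`, so it is a `p`-th power of some `y`.
  -- Replacing `y` by an element of `K` with the same projection does not change this power.
  have h0 : D.proj (k⁻¹ * x) = 0 := by rw [proj_mul, proj_inv, hkx, neg_add_cancel]
  obtain ⟨a, ha⟩ := (D.proj_eq_zero_iff _).1 h0
  obtain ⟨y, rfl⟩ := D.proj_surjective a
  obtain ⟨l, hl, hly⟩ := h' y
  rw [← hly, emb_proj] at ha
  have := K.mul_mem hk (ha ▸ K.pow_mem hl p)
  rwa [mul_inv_cancel_left] at this

/-- The preimage in `G` of a subspace of `L`. -/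
def preimage (W : Submodule (ZMod p) L) : Subgroup G :=
  (AddSubgroup.toSubgroup W.toAddSubgroup).comap D.projHom

/-- The inverse image in `L` of a subgroup of `G`, under the embedding. -/
def embPreimage (K : Subgroup G) : Submodule (ZMod p) L :=
  AddSubgroup.toZModSubmodule p (Subgroup.toAddSubgroup' (K.comap D.embHom))

theorem mem_embPreimage {K : Subgroup G} {a : L} : a ∈ D.embPreimage K ↔ D.emb a ∈ K := Iff.rfl

variable [Fact p.Prime] [Fact (p ≠ 2)] [IsScalarTower (ZMod p) L L] [SMulCommClass (ZMod p) L L]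
  [Module.Finite (ZMod p) L]

/-- The characteristic subgroups of an extension of an IAC algebra are the trivial ones and the
kernel of the projection. -/
theorem characteristic_cases (h : IsIAC (ZMod p) L) {K : Subgroup G} (hK : K.Characteristic) :
    K = ⊥ ∨ K = D.projHom.ker ∨ K = ⊤ := by
  have lift : ∀ f ∈ algAut (ZMod p) L, ∃ e : G ≃* G, ∀ x, D.proj (e x) = f (D.proj x) :=
    fun f hf => D.exists_lift D f hf
  have hKe : ∀ (e : G ≃* G), ∀ x ∈ K, e x ∈ K := fun e x hx =>
    Subgroup.characteristic_iff_le_comap.1 hK e hx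
  -- Irreducibility is used twice: for the image of `K` in the quotient `L`, and, when that is zero,
  -- for the part of `L` that `emb` sends into `K`. Invariance comes from lifting automorphisms of
  -- `L` to `G`.
  have himage := h.irreducible (D.image K) fun f hf a ha => by
    obtain ⟨x, hx, rfl⟩ : ∃ x ∈ K, D.proj x = a := ha
    obtain ⟨e, he⟩ := lift f hf
    exact D.mem_image.2 ⟨e x, hKe e x hx, he x⟩
  rcases himage with himage | himage
  · have h0 : ∀ x ∈ K, D.proj x = 0 := fun x hx => by
      have : D.proj x ∈ D.image K := D.mem_image.2 ⟨x, hx, rfl⟩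
      rwa [himage, Submodule.mem_bot] at this
    have hpre : D.embPreimage K = ⊥ ∨ D.embPreimage K = ⊤ := by
      refine h.irreducible _ fun f hf a ha => ?_
      obtain ⟨x, rfl⟩ := D.proj_surjective a
      obtain ⟨e, he⟩ := lift f hf
      have hx : D.emb (D.proj x) ∈ K := ha
      change D.emb (f (D.proj x)) ∈ K
      rw [← he, emb_proj, ← map_pow, ← D.emb_proj]
      exact hKe e _ hx
    rcases hpre with hpre | hpre
    · left
      rw [Subgroup.eq_bot_iff_forall]
      intro x hx
      obtain ⟨a, rfl⟩ := (D.proj_eq_zero_iff x).1 (h0 x hx)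
      have : a ∈ D.embPreimage K := hx
      rw [hpre, Submodule.mem_bot] at this
      rw [this, emb_zero]
    · right; left
      refine le_antisymm h0 fun x hx => ?_
      obtain ⟨a, rfl⟩ := (D.proj_eq_zero_iff x).1 hx
      exact D.mem_embPreimage.1 (hpre ▸ Submodule.mem_top)
  · exact Or.inr (Or.inr (D.eq_top_of_image_eq_top himage))

/-- A group that is an extension of an IAC algebra is a UCS group. -/
theorem isUCSPSq (D : PowerExtension p G L) (h : IsIAC (ZMod p) L) : IsUCSPSq p G where
  isPGroup := fun x => ⟨2, D.pow_sq_eq_one x⟩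
  exponent := by
    obtain ⟨k, hk, he⟩ := (Nat.dvd_prime_pow Fact.out).1
      (Monoid.exponent_dvd_of_forall_pow_eq_one D.pow_sq_eq_one)
    rcases hk.eq_or_lt with rfl | hk
    · exact he
    -- An exponent dividing `p` would make `proj` vanish, but `L` is non-zero.
    · obtain ⟨a, ha⟩ := @exists_ne L h.nontrivial 0
      obtain ⟨x, rfl⟩ := D.proj_surjective a
      refine absurd ((D.proj_eq_zero_iff_pow x).2 ?_) ha
      refine Monoid.exponent_dvd_iff_forall_pow_eq_one.1 ?_ x
      rw [he]
      exact (pow_dvd_pow p (Nat.le_of_lt_succ hk)).trans (pow_one p).dvd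
  ucs := by
    obtain ⟨a, ha⟩ := @exists_ne L h.nontrivial 0
    refine ⟨D.projHom.ker, ⟨?_, ?_, ?_⟩, ?_⟩
    · rw [Subgroup.characteristic_iff_le_comap]
      intro e x hx
      have hx' : D.proj x = 0 := hx
      change D.proj (e x) = 0
      rw [proj_eq_zero_iff_pow] at hx' ⊢
      rw [← map_pow, hx', map_one]
    · intro h0
      have : D.emb a ∈ D.projHom.ker := D.proj_emb a
      rw [h0, Subgroup.mem_bot, emb_eq_one_iff] at this
      exact ha this
    · intro h0
      obtain ⟨x, rfl⟩ := D.proj_surjective a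
      exact ha (h0 ▸ Subgroup.mem_top x : x ∈ D.projHom.ker)
    · rintro K ⟨hK, hb, ht⟩
      rcases D.characteristic_cases h hK with hc | hc | hc
      · exact absurd hc hb
      · exact hc
      · exact absurd hc ht

end PowerExtension

/-! ### The extension given by a UCS group -/

section Canonical

variable (p : ℕ) [Fact p.Prime] [Fact (p ≠ 2)] (G : Type u) [Group G] [Finite G] [IsUCSPSq p G]

/-- A UCS group of exponent `p ^ 2` as an extension of `L(G)`. -/
noncomputable def canonicalExtension : PowerExtension p G (LAlg p G) where
  proj := LAlg.mk p
  emb a := (powEquiv p G a.toMul : frattini G)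
  proj_mul _ _ := rfl
  emb_add a b := congrArg Subtype.val (map_mul (powEquiv p G) a.toMul b.toMul)
  proj_surjective := fun a => by
    induction a using LAlg.ind with | _ g
    exact ⟨g, rfl⟩
  emb_injective := Subtype.val_injective.comp (powEquiv p G).injective
  proj_eq_zero_iff x := by
    refine (QuotientGroup.eq_one_iff x).trans
      ⟨fun hx => ⟨Additive.ofMul ((powEquiv p G).symm ⟨x, hx⟩), ?_⟩, ?_⟩
    · exact congrArg Subtype.val ((powEquiv p G).apply_symm_apply ⟨x, hx⟩)
    · rintro ⟨a, rfl⟩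
      exact Subtype.property _
  emb_proj := powEquiv_mk p G
  comm_eq x y := congrArg Subtype.val ((powEquiv p G).apply_symm_apply (comm p G x y)).symm

theorem mem_frattini_iff (x : G) : x ∈ frattini G ↔ LAlg.mk p x = 0 :=
  (QuotientGroup.eq_one_iff x).symm

theorem mk_surjective : Surjective (LAlg.mk p : G → LAlg p G) :=
  fun a => (canonicalExtension p G).proj_surjective a

/-- An invariant subspace pulls back to a characteristic subgroup containing `Φ(G)`, because
automorphisms of `G` induce automorphisms of `L(G)`. That subgroup can only be `Φ(G)` or `G`. -/
theorem isIAC_LAlg : IsIAC (ZMod p) (LAlg p G) where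
  mul_self := (canonicalExtension p G).mul_self
  nontrivial := by
    obtain ⟨x, hx⟩ : ∃ x, x ∉ frattini G := by
      by_contra! h
      exact frattini_ne_top p G ((Subgroup.eq_top_iff' _).2 h)
    exact ⟨LAlg.mk p x, 0, fun h => hx ((mem_frattini_iff p G x).2 h)⟩
  irreducible W hW := by
    let D := canonicalExtension p G
    have hchar : (D.preimage W).Characteristic := by
      rw [Subgroup.characteristic_iff_le_comap]
      intro e x hx
      obtain ⟨f, hf, hfe⟩ := D.exists_map D e
      change D.proj (e x) ∈ W
      rw [hfe]
      exact hW f hf _ hx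
    have hmem : ∀ x, x ∈ D.preimage W ↔ LAlg.mk p x ∈ W := fun _ => Iff.rfl
    rcases char_cases p G _ hchar with h | h | h
    · refine absurd (le_bot_iff.1 (h ▸ fun x hx => ?_)) (frattini_ne_bot p G)
      rw [hmem, (mem_frattini_iff p G x).1 hx]
      exact W.zero_mem
    · left
      rw [Submodule.eq_bot_iff]
      intro a ha
      obtain ⟨x, rfl⟩ := mk_surjective p G a
      rwa [← mem_frattini_iff, ← h, hmem]
    · right
      rw [Submodule.eq_top_iff']
      intro a
      obtain ⟨x, rfl⟩ := mk_surjective p G a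
      rw [← hmem, h]
      exact Subgroup.mem_top x

variable {p G}

/-- The algebra of an extension is the algebra of the group. -/
theorem PowerExtension.algIso_LAlg {L : Type*} [NonUnitalNonAssocRing L] [Module (ZMod p) L]
    (D : PowerExtension p G L) : AlgIso (ZMod p) (LAlg p G) L := by
  obtain ⟨f, hf, -⟩ := (canonicalExtension p G).exists_map D (MulEquiv.refl G)
  exact ⟨f, hf⟩

end Canonical

/-! ### The bijection between isomorphism classes -/

section Bijection

variable (p : ℕ) [Fact p.Prime] [Fact (p ≠ 2)]

/-- One direction makes the map on isomorphism classes well defined, the other makes it injective.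
-/
theorem nonempty_mulEquiv_iff (G H : Type u) [Group G] [Finite G] [IsUCSPSq p G] [Group H]
    [Finite H] [IsUCSPSq p H] :
    Nonempty (G ≃* H) ↔ AlgIso (ZMod p) (LAlg p G) (LAlg p H) := by
  constructor
  · rintro ⟨e⟩
    obtain ⟨f, hf, -⟩ := (canonicalExtension p G).exists_map (canonicalExtension p H) e
    exact ⟨f, hf⟩
  · rintro ⟨f, hf⟩
    obtain ⟨e, -⟩ := (canonicalExtension p G).exists_lift (canonicalExtension p H) f hf
    exact ⟨e⟩

/-- Every finite-dimensional IAC algebra is the algebra of a UCS group. -/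
theorem exists_group_of_isIAC (L : Type u) [NonUnitalNonAssocRing L] [Module (ZMod p) L]
    [IsScalarTower (ZMod p) L L] [SMulCommClass (ZMod p) L L] [Module.Finite (ZMod p) L]
    (h : IsIAC (ZMod p) L) :
    ∃ (G : Type u) (_ : Group G) (_ : Finite G) (_ : IsUCSPSq p G),
      AlgIso (ZMod p) (LAlg p G) L := by
  let b := Module.Free.chooseBasis (ZMod p) L
  let E := stdExtension b
  have : NeZero (p ^ 2) := ⟨(pow_pos (Fact.out : p.Prime).pos 2).ne'⟩
  have hfin : Finite (Module.Free.ChooseBasisIndex (ZMod p) L → ZMod (p ^ 2)) := inferInstance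
  let _ := E.group h.mul_self
  have hU := (E.toPowerExtension h.mul_self).isUCSPSq h
  exact ⟨_, _, hfin, hU, (E.toPowerExtension h.mul_self).algIso_LAlg⟩

/-- The map induced by `G ↦ L(G)` on isomorphism classes. -/
noncomputable def classMap : UCSClasses.{u} p → IACClasses.{u} p :=
  Quotient.map (fun G => ⟨LAlg p G.carrier, isIAC_LAlg p G.carrier⟩) fun G H h =>
    (nonempty_mulEquiv_iff p G.carrier H.carrier).1 h

theorem classMap_bijective : Bijective (classMap.{u} p) := by
  constructor
  · rintro ⟨G⟩ ⟨H⟩ h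
    exact Quotient.sound ((nonempty_mulEquiv_iff p G.carrier H.carrier).2 (Quotient.exact h))
  · rintro ⟨L⟩
    obtain ⟨G, _, _, _, h⟩ := exists_group_of_isIAC p L.carrier L.isIAC
    exact ⟨UCSClasses.mk p G, Quotient.sound h⟩

end Bijection

end UCS

/-! ### Direct powers -/

section Powers

/-- The direct power of an extension. -/
def PowerExtension.pi {p : ℕ} {G L : Type*} [Group G] [NonUnitalNonAssocRing L]
    (D : PowerExtension p G L) (κ : Type*) : PowerExtension p (κ → G) (κ → L) where
  proj x j := D.proj (x j)
  emb a j := D.emb (a j)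
  proj_mul _ _ := funext fun _ => D.proj_mul _ _
  emb_add _ _ := funext fun _ => D.emb_add _ _
  proj_surjective := D.proj_surjective.comp_left
  emb_injective := D.emb_injective.comp_left
  proj_eq_zero_iff x := by
    constructor
    · intro h
      choose a ha using fun j => (D.proj_eq_zero_iff (x j)).1 (congrFun h j)
      exact ⟨a, funext ha⟩
    · rintro ⟨a, rfl⟩
      exact funext fun _ => D.proj_emb _
  emb_proj _ := funext fun _ => D.emb_proj _
  comm_eq _ _ := funext fun _ => D.comm_eq _ _

variable {p : ℕ} [Fact p.Prime] [Fact (p ≠ 2)] {L : Type*} [NonUnitalNonAssocRing L]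
  [Module (ZMod p) L] [IsScalarTower (ZMod p) L L] [SMulCommClass (ZMod p) L L]

/-- Automorphisms of an IAC algebra in odd characteristic fix no non-zero element. -/
theorem IsIAC.exists_apply_ne (h : IsIAC (ZMod p) L) {w : L} (hw : w ≠ 0) :
    ∃ f ∈ algAut (ZMod p) L, f w ≠ w := by
  by_contra! hfix
  -- The line through a fixed vector is invariant, so it is all of `L`. Then the product is zero and
  -- `-1` is an automorphism fixing `w`, impossible for odd `p`.
  have hspan : Submodule.span (ZMod p) {w} = ⊤ := by
    refine (h.irreducible _ fun f hf v hv => ?_).resolve_left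
      fun h0 => hw (Submodule.span_singleton_eq_bot.1 h0)
    obtain ⟨c, rfl⟩ := Submodule.mem_span_singleton.1 hv
    rw [map_smul, hfix f hf]
    exact hv
  have hzero : ∀ x y : L, x * y = 0 := by
    intro x y
    obtain ⟨c, rfl⟩ := Submodule.mem_span_singleton.1 (hspan ▸ Submodule.mem_top : x ∈ _)
    obtain ⟨d, rfl⟩ := Submodule.mem_span_singleton.1 (hspan ▸ Submodule.mem_top : y ∈ _)
    rw [smul_mul_assoc, mul_smul_comm, h.mul_self, smul_zero, smul_zero]
  have hneg : -w = w := hfix (LinearEquiv.neg (ZMod p)) fun x y => by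
    rw [hzero, hzero, map_zero]
  have h2 : (2 : ZMod p) • w = 0 := by
    rw [two_smul]
    nth_rw 1 [← hneg]
    exact neg_add_cancel w
  exact (smul_eq_zero.1 h2).elim (two_ne_zero_zmod p) hw

/-- Direct powers of IAC algebras are IAC algebras. -/
theorem IsIAC.pi (h : IsIAC (ZMod p) L) (κ : Type*) [Finite κ] [Nonempty κ] :
    IsIAC (ZMod p) (κ → L) where
  mul_self x := funext fun j => h.mul_self (x j)
  nontrivial := by
    have := h.nontrivial
    infer_instance
  irreducible W hW := by
    classical
    have := Fintype.ofFinite κ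
    refine or_iff_not_imp_left.2 fun hne => ?_
    obtain ⟨w, hwW, hw⟩ := Submodule.exists_mem_ne_zero_of_ne_bot hne
    obtain ⟨j, hj⟩ := Function.ne_iff.1 hw
    -- Apply `f` in the coordinate `j` only.
    let act : (L ≃ₗ[ZMod p] L) → ((κ → L) ≃ₗ[ZMod p] (κ → L)) := fun f =>
      LinearEquiv.piCongrRight (update (fun _ => LinearEquiv.refl (ZMod p) L) j f)
    have act_same : ∀ f x, act f x j = f (x j) := fun f x => by
      change update (fun _ => LinearEquiv.refl (ZMod p) L) j f j (x j) = _
      rw [update_self]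
    have act_ne : ∀ f x i, i ≠ j → act f x i = x i := fun f x i hi => by
      change update (fun _ => LinearEquiv.refl (ZMod p) L) j f i (x i) = _
      rw [update_of_ne hi]
      rfl
    have act_mem : ∀ f ∈ algAut (ZMod p) L, act f ∈ algAut (ZMod p) (κ → L) := by
      intro f hf x y
      ext i
      by_cases hi : i = j
      · subst hi
        rw [Pi.mul_apply, act_same, act_same, act_same, Pi.mul_apply, hf]
      · rw [Pi.mul_apply, act_ne _ _ _ hi, act_ne _ _ _ hi, act_ne _ _ _ hi, Pi.mul_apply]
    have hU : W.comap (LinearMap.single (ZMod p) (fun _ => L) j) = ⊤ := by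
      refine (h.irreducible _ fun f hf a ha => ?_).resolve_left fun h0 => ?_
      · have hs : act f (Pi.single j a) = Pi.single j (f a) := by
          ext i
          by_cases hi : i = j
          · subst hi
            rw [act_same, Pi.single_eq_same, Pi.single_eq_same]
          · rw [act_ne _ _ _ hi, Pi.single_eq_of_ne hi, Pi.single_eq_of_ne hi]
        change Pi.single j (f a) ∈ W
        rw [← hs]
        exact hW _ (act_mem f hf) _ ha
      -- Moving the `j`-th coordinate of `w` and subtracting `w` leaves a non-zero vector of `W`
      -- supported at `j`.
      · obtain ⟨f, hf, hfw⟩ := h.exists_apply_ne hj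
        have hs : act f w - w = Pi.single j (f (w j) - w j) := by
          ext i
          by_cases hi : i = j
          · subst hi
            rw [Pi.sub_apply, act_same, Pi.single_eq_same]
          · rw [Pi.sub_apply, act_ne _ _ _ hi, Pi.single_eq_of_ne hi, sub_self]
        have hmem : f (w j) - w j ∈ W.comap (LinearMap.single (ZMod p) (fun _ => L) j) := by
          change Pi.single j _ ∈ W
          rw [← hs]
          exact W.sub_mem (hW _ (act_mem f hf) _ hwW) hwW
        rw [h0, Submodule.mem_bot, sub_eq_zero] at hmem
        exact hfw hmem
    have hsingle : ∀ i a, Pi.single i a ∈ W := by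
      intro i a
      have hmem : Pi.single j a ∈ W :=
        (hU ▸ Submodule.mem_top : a ∈ W.comap (LinearMap.single (ZMod p) (fun _ => L) j))
      -- Permuting coordinates is an automorphism, so one full factor inside `W` yields all of them.
      have := hW (LinearEquiv.funCongrLeft (ZMod p) L (Equiv.swap i j)) (fun _ _ => rfl) _ hmem
      convert this using 1
      ext l
      change _ = (Pi.single j a : κ → L) (Equiv.swap i j l)
      rw [Pi.single_apply, Pi.single_apply, Equiv.swap_apply_eq_iff, Equiv.swap_apply_right]
    rw [Submodule.eq_top_iff']
    intro x
    rw [← Finset.univ_sum_single x]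
    exact W.sum_mem fun i _ => hsingle i _

end Powers

section Parts

/-! ### Automorphism groups -/

theorem mk_eq_mk_iff (p : ℕ) {G : Type u} [Group G] (x y : G) :
    LAlg.mk p x = LAlg.mk p y ↔ x⁻¹ * y ∈ frattini G :=
  QuotientGroup.eq

theorem mem_frattiniAut_iff (p : ℕ) {G : Type u} [Group G] (α : MulAut G) :
    α ∈ frattiniAut G ↔ ∀ g, LAlg.mk p (α g) = LAlg.mk p g := by
  constructor
  · intro h g
    exact DFunLike.congr_fun (MonoidHom.mem_ker.1 h) (g : G ⧸ frattini G)
  · intro h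
    refine MonoidHom.mem_ker.2 (MulEquiv.ext fun x => ?_)
    induction x using QuotientGroup.induction_on with | _ g
    exact h g

theorem mem_centralAut_iff {G : Type*} [Group G] (α : MulAut G) :
    α ∈ centralAut G ↔ ∀ g, (α g)⁻¹ * g ∈ Subgroup.center G := by
  constructor
  · intro h g
    exact QuotientGroup.eq.1
      (DFunLike.congr_fun (MonoidHom.mem_ker.1 h) (g : G ⧸ Subgroup.center G))
  · intro h
    refine MonoidHom.mem_ker.2 (MulEquiv.ext fun x => ?_)
    induction x using QuotientGroup.induction_on with | _ g
    exact QuotientGroup.eq.2 (h g)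

/-! ### Automorphisms trivial on the quotient -/

namespace PowerExtension

variable {p : ℕ} {G L : Type*} [Group G] [NonUnitalNonAssocRing L] [Module (ZMod p) L]
  (D : PowerExtension p G L)

/-- The automorphism `x ↦ x * emb (f (proj x))`. -/
def twist (f : L →ₗ[ZMod p] L) : MulAut G where
  toFun x := x * D.emb (f (D.proj x))
  invFun x := x * D.emb (-f (D.proj x))
  left_inv x := by
    change x * D.emb (f (D.proj x)) * D.emb (-f (D.proj (x * D.emb (f (D.proj x))))) = x
    rw [proj_mul, proj_emb, add_zero, mul_assoc, ← emb_add, add_neg_cancel, emb_zero, mul_one]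
  right_inv x := by
    change x * D.emb (-f (D.proj x)) * D.emb (f (D.proj (x * D.emb (-f (D.proj x))))) = x
    rw [proj_mul, proj_emb, add_zero, mul_assoc, ← emb_add, neg_add_cancel, emb_zero, mul_one]
  map_mul' x y := by
    rw [proj_mul, map_add, emb_add, ← mul_assoc, mul_assoc x y, ← D.emb_comm _ y]
    simp only [mul_assoc]

/-- The twisting automorphisms, as a homomorphism. -/
def twistHom : Multiplicative (L →ₗ[ZMod p] L) →* MulAut G :=
  MonoidHom.mk' (fun f => D.twist f.toAdd) fun f g => MulEquiv.ext fun x => by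
    change x * D.emb (f.toAdd (D.proj x) + g.toAdd (D.proj x)) = x * D.emb (g.toAdd (D.proj x)) *
      D.emb (f.toAdd (D.proj (x * D.emb (g.toAdd (D.proj x)))))
    rw [proj_mul, proj_emb, add_zero, mul_assoc, ← emb_add, add_comm]

theorem twistHom_injective : Injective D.twistHom := by
  intro f g h
  refine LinearMap.ext (f := f.toAdd) (g := g.toAdd) fun a => ?_
  obtain ⟨x, rfl⟩ := D.proj_surjective a
  have hx : x * D.emb (f.toAdd (D.proj x)) = x * D.emb (g.toAdd (D.proj x)) :=
    DFunLike.congr_fun h x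
  exact D.emb_injective (mul_left_cancel hx)

/-- If `α` is trivial on the quotient, then `α x = x * emb (φ x)`, and centrality of `emb` makes `φ`
a homomorphism. It kills the kernel of `proj`, so it descends to an additive, hence `ZMod p`-linear,
endomorphism of `L`. -/
theorem mem_range_twistHom (α : MulAut G) :
    α ∈ D.twistHom.range ↔ ∀ x, D.proj (α x) = D.proj x := by
  constructor
  · rintro ⟨f, rfl⟩ x
    change D.proj (x * D.emb _) = _
    rw [proj_mul, proj_emb, add_zero]
  · intro h
    have h0 : ∀ x, ∃ a, D.emb a = x⁻¹ * α x := fun x =>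
      (D.proj_eq_zero_iff _).1 (by rw [proj_mul, proj_inv, h, neg_add_cancel])
    choose φ hφ using h0
    have hα : ∀ x, α x = x * D.emb (φ x) := fun x => by rw [hφ, mul_inv_cancel_left]
    have hmul : ∀ x y, φ (x * y) = φ x + φ y := by
      intro x y
      apply D.emb_injective
      rw [hφ, map_mul, hα, hα y, emb_add, mul_assoc x, ← mul_assoc _ y, emb_comm]
      group
    -- Elements of the kernel are `p`-th powers, and `x ^ p` depends only on `proj x`, so `α` fixes
    -- them.
    have hemb : ∀ a, φ (D.emb a) = 0 := by
      intro a
      obtain ⟨x, rfl⟩ := D.proj_surjective a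
      rw [← D.emb_eq_one_iff, hφ, emb_proj, map_pow, ← D.emb_proj (α x), h, emb_proj,
        inv_mul_cancel]
    have hcongr : ∀ x y, D.proj x = D.proj y → φ x = φ y := by
      intro x y hxy
      obtain ⟨a, ha⟩ := (D.proj_eq_zero_iff (x⁻¹ * y)).1
        (by rw [proj_mul, proj_inv, hxy, neg_add_cancel])
      have := hmul x (D.emb a)
      rwa [hemb, add_zero, ha, mul_inv_cancel_left, eq_comm] at this
    let s := surjInv D.proj_surjective
    have hs : ∀ a, D.proj (s a) = a := surjInv_eq D.proj_surjective
    let f : L →+ L := AddMonoidHom.mk' (fun a => φ (s a)) fun a b => by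
      rw [← hmul]
      exact hcongr _ _ (by rw [proj_mul, hs, hs, hs])
    refine ⟨Multiplicative.ofAdd (f.toZModLinearMap p), MulEquiv.ext fun x => ?_⟩
    change x * D.emb (φ (s (D.proj x))) = α x
    rw [hcongr _ _ (hs (D.proj x)), ← hα]

end PowerExtension

variable (p : ℕ) [Fact p.Prime] [Fact (p ≠ 2)] (G : Type u) [Group G] [Finite G] [IsUCSPSq p G]

/-- The centre is characteristic and non-trivial, and proper when `G` is non-abelian, so it is
`Φ(G)`. -/
theorem centralAut_eq_frattiniAut (p : ℕ) [Fact p.Prime] (G : Type u) [Group G] [Finite G]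
    [IsUCSPSq p G] (h : ∃ x y : G, x * y ≠ y * x) :
    centralAut G = frattiniAut G := by
  have hc : Subgroup.center G = frattini G := by
    have := nontrivial_of_ucs p G
    rcases char_cases p G (Subgroup.center G) inferInstance with hc | hc | hc
    · exact absurd hc (IsUCSPSq.isPGroup (p := p) (G := G)).bot_lt_center.ne'
    · exact hc
    · obtain ⟨x, y, hxy⟩ := h
      exact absurd (Subgroup.mem_center_iff.1 (hc ▸ Subgroup.mem_top y) x) hxy
  ext α
  rw [mem_centralAut_iff, mem_frattiniAut_iff p]
  exact forall_congr' fun g => by rw [mk_eq_mk_iff, hc]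

/-- The isomorphism `Aut(G) / K ≃ Aut(L(G))`. -/
theorem exists_autEquiv :
    ∃ e : MulAut G ⧸ frattiniAut G ≃* algAut (ZMod p) (LAlg p G),
      ∀ (α : MulAut G) (g : G),
        (e (α : MulAut G ⧸ frattiniAut G) : LAlg p G ≃ₗ[ZMod p] LAlg p G) (LAlg.mk p g)
          = LAlg.mk p (α g) := by
  let D := canonicalExtension p G
  choose F hF hmk using fun α : MulAut G => D.exists_map D α
  replace hmk : ∀ (α : MulAut G) (g : G), LAlg.mk p (α g) = F α (LAlg.mk p g) := hmk
  let Ψ : MulAut G →* algAut (ZMod p) (LAlg p G) := MonoidHom.mk' (fun α => ⟨F α, hF α⟩) (by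
    intro α β
    refine Subtype.ext (LinearEquiv.ext fun a => ?_)
    obtain ⟨g, rfl⟩ := mk_surjective p G a
    change F (α * β) (LAlg.mk p g) = F α (F β (LAlg.mk p g))
    rw [← hmk, ← hmk, ← hmk]
    rfl)
  have hΨ : ∀ (α : MulAut G) (g : G),
      (Ψ α : LAlg p G ≃ₗ[ZMod p] LAlg p G) (LAlg.mk p g) = LAlg.mk p (α g) :=
    fun α g => (hmk α g).symm
  have hker : frattiniAut G = Ψ.ker := by
    ext α
    rw [mem_frattiniAut_iff p, MonoidHom.mem_ker]
    constructor
    · intro h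
      refine Subtype.ext (LinearEquiv.ext fun a => ?_)
      obtain ⟨g, rfl⟩ := mk_surjective p G a
      rw [hΨ, h]
      rfl
    · intro h g
      rw [← hΨ, h]
      rfl
  have hsurj : Surjective Ψ := by
    rintro ⟨f, hf⟩
    obtain ⟨α, hα⟩ := D.exists_lift D f hf
    refine ⟨α, Subtype.ext (LinearEquiv.ext fun a => ?_)⟩
    obtain ⟨g, rfl⟩ := mk_surjective p G a
    rw [hΨ]
    exact hα g
  exact ⟨(QuotientGroup.quotientMulEquivOfEq hker).trans
    (QuotientGroup.quotientKerEquivOfSurjective Ψ hsurj), hΨ⟩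

theorem frattiniAut_eq_range : frattiniAut G = (canonicalExtension p G).twistHom.range := by
  ext α
  rw [mem_frattiniAut_iff p, PowerExtension.mem_range_twistHom]
  rfl

/-- Burnside's basis theorem: generators of `G` span `L(G)`, and lifts of a basis generate `G` by
`eq_top_of_image_eq_top`. -/
theorem finrank_LAlg : Module.finrank (ZMod p) (LAlg p G) = Group.rank G := by
  classical
  let D := canonicalExtension p G
  apply le_antisymm
  · obtain ⟨S, hS, hcl⟩ := Group.rank_spec G
    have hspan : Submodule.span (ZMod p) ((S.image (LAlg.mk p) : Finset (LAlg p G)) :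
        Set (LAlg p G)) = ⊤ := by
      have hle : Subgroup.closure (S : Set G) ≤
          D.preimage (Submodule.span (ZMod p) (S.image (LAlg.mk p) : Finset (LAlg p G))) := by
        rw [Subgroup.closure_le]
        intro x hx
        exact Submodule.subset_span (Finset.mem_coe.2 (Finset.mem_image_of_mem _ hx))
      rw [Submodule.eq_top_iff']
      intro a
      obtain ⟨g, rfl⟩ := mk_surjective p G a
      exact hle (hcl ▸ Subgroup.mem_top g)
    rw [← hS, ← finrank_top (ZMod p) (LAlg p G), ← hspan]
    exact (finrank_span_finset_le_card _).trans Finset.card_image_le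
  · let b := Module.finBasis (ZMod p) (LAlg p G)
    choose g hg using fun j => mk_surjective p G (b j)
    have hcl : Subgroup.closure ((Finset.univ.image g : Finset G) : Set G) = ⊤ := by
      apply D.eq_top_of_image_eq_top
      rw [eq_top_iff, ← b.span_eq, Submodule.span_le]
      rintro _ ⟨j, rfl⟩
      exact ⟨g j, Subgroup.subset_closure (by simp), hg j⟩
    refine (Group.rank_le hcl).trans (Finset.card_image_le.trans ?_)
    rw [Finset.card_univ, Fintype.card_fin]

theorem card_frattiniAut : Nat.card (frattiniAut G) = p ^ (Group.rank G ^ 2) := by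
  rw [frattiniAut_eq_range p, ← Nat.card_congr
    (MonoidHom.ofInjective (canonicalExtension p G).twistHom_injective).toEquiv,
    Nat.card_congr Multiplicative.toAdd, Module.natCard_eq_pow_finrank (K := ZMod p),
    Module.finrank_linearMap, finrank_LAlg, Nat.card_zmod, sq]

theorem frattiniAut_comm (p : ℕ) [Fact p.Prime] [Fact (p ≠ 2)] (G : Type u) [Group G] [Finite G]
    [IsUCSPSq p G] (α β : MulAut G) (hα : α ∈ frattiniAut G)
    (hβ : β ∈ frattiniAut G) :
    α * β = β * α := by
  rw [frattiniAut_eq_range p] at hα hβ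
  obtain ⟨f, rfl⟩ := hα
  obtain ⟨g, rfl⟩ := hβ
  rw [← map_mul, mul_comm, map_mul]

theorem frattiniAut_pow (α : MulAut G) (hα : α ∈ frattiniAut G) : α ^ p = 1 := by
  rw [frattiniAut_eq_range p] at hα
  obtain ⟨f, rfl⟩ := hα
  rw [← map_pow, ← ofAdd_toAdd f, ← ofAdd_nsmul, ← Nat.cast_smul_eq_nsmul (ZMod p),
    CharP.cast_eq_zero, zero_smul, ofAdd_zero, map_one]

/-! ### Powerful subgroups -/

/-- As the `p`-th power map is a homomorphism, the `p`-th powers of elements of `H` already form a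
subgroup. -/
theorem mem_powersSubgroup_iff (H : Subgroup G) (x : G) :
    x ∈ powersSubgroup p H ↔ ∃ h ∈ H, h ^ p = x := by
  have : powersSubgroup p H = H.map ((frattini G).subtype.comp (powHom p G)) := by
    rw [powersSubgroup, ← Subgroup.closure_eq (H.map _)]
    rfl
  rw [this]
  exact Iff.rfl

/-- A commutator is a `p`-th power of an element of `H` if and only if the corresponding
product lies in the image of `H`. -/
theorem comm_mem_powersSubgroup_iff (H : Subgroup G) (x y : G) :
    x⁻¹ * y⁻¹ * x * y ∈ powersSubgroup p H ↔
      LAlg.mk p x * LAlg.mk p y ∈ (canonicalExtension p G).image H := by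
  let D := canonicalExtension p G
  have h1 : x⁻¹ * y⁻¹ * x * y = D.emb (LAlg.mk p x * LAlg.mk p y) := D.comm_eq x y
  rw [mem_powersSubgroup_iff, h1, D.mem_image]
  refine exists_congr fun h => and_congr_right fun _ => ?_
  rw [← D.emb_proj, D.emb_injective.eq_iff]

theorem commutator_le_powersSubgroup_iff (H K : Subgroup G) :
    ⁅H, K⁆ ≤ powersSubgroup p H ↔
      ∀ x ∈ H, ∀ y ∈ K, LAlg.mk p x * LAlg.mk p y ∈ (canonicalExtension p G).image H := by
  rw [Subgroup.commutator_le]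
  constructor
  · intro h x hx y hy
    rw [← comm_mem_powersSubgroup_iff]
    -- Mathlib's commutator is `x * y * x⁻¹ * y⁻¹`; inverting both arguments converts it to the
    -- convention defining `L(G)`.
    have := h x⁻¹ (H.inv_mem hx) y⁻¹ (K.inv_mem hy)
    rwa [commutatorElement_def, inv_inv, inv_inv] at this
  · intro h x hx y hy
    have := (comm_mem_powersSubgroup_iff p G H _ _).2
      (h x⁻¹ (H.inv_mem hx) y⁻¹ (K.inv_mem hy))
    rwa [inv_inv, inv_inv] at this

theorem mk_mem_image_iff {H : Subgroup G} (hH : frattini G ≤ H) (x : G) :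
    LAlg.mk p x ∈ (canonicalExtension p G).image H ↔ x ∈ H := by
  constructor
  · rintro ⟨y, hy, hyx⟩
    have := H.mul_mem hy (hH ((mk_eq_mk_iff p y x).1 hyx))
    rwa [mul_inv_cancel_left] at this
  · exact fun hx => ⟨x, hx, rfl⟩

/-- The correspondence between powerful subgroups and subalgebras. -/
noncomputable def powerfulEquiv :
    {H : Subgroup G // frattini G ≤ H ∧ IsPowerful p H} ≃
      NonUnitalSubalgebra (ZMod p) (LAlg p G) where
  toFun H :=
    { (canonicalExtension p G).image H.1 with
      mul_mem' := by
        rintro _ _ ⟨x, hx, rfl⟩ ⟨y, hy, rfl⟩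
        exact (commutator_le_powersSubgroup_iff p G H.1 H.1).1 H.2.2 x hx y hy }
  invFun S := ⟨(canonicalExtension p G).preimage S.toSubmodule, by
    intro x hx
    change LAlg.mk p x ∈ S
    rw [(mem_frattini_iff p G x).1 hx]
    exact S.zero_mem, (commutator_le_powersSubgroup_iff p G _ _).2 fun x hx y hy => by
    obtain ⟨z, hz⟩ := mk_surjective p G (LAlg.mk p x * LAlg.mk p y)
    refine ⟨z, ?_, hz⟩
    change LAlg.mk p z ∈ S
    rw [hz]
    exact S.mul_mem hx hy⟩
  left_inv H := Subtype.ext (Subgroup.ext fun x => mk_mem_image_iff p G H.2.1 x)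
  right_inv S := by
    ext a
    obtain ⟨x, rfl⟩ := mk_surjective p G a
    constructor
    · rintro ⟨y, hy, hyx⟩
      have hy' : LAlg.mk p y ∈ S := hy
      rwa [show LAlg.mk p y = LAlg.mk p x from hyx] at hy'
    · exact fun hx => ⟨x, hx, rfl⟩

/-- Being powerfully embedded says that the image absorbs products from the right;
anti-commutativity supplies the other side. -/
theorem isIdealOf_powerfulEquiv_iff
    (H : {H : Subgroup G // frattini G ≤ H ∧ IsPowerful p H}) :
    IsIdealOf (powerfulEquiv p G H) ↔ IsPowerfullyEmbedded p H.1 := by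
  rw [IsPowerfullyEmbedded, commutator_le_powersSubgroup_iff]
  constructor
  · intro h x hx y _
    exact (h (LAlg.mk p x) ⟨x, hx, rfl⟩ (LAlg.mk p y)).1
  · rintro h _ ⟨x, hx, rfl⟩ b
    obtain ⟨y, rfl⟩ := mk_surjective p G b
    have hxy := h x hx y (Subgroup.mem_top y)
    have hswap : LAlg.mk p y * LAlg.mk p x = -(LAlg.mk p x * LAlg.mk p y) := by
      have hself := (canonicalExtension p G).mul_self
      have := hself (LAlg.mk p y + LAlg.mk p x)
      rw [mul_add, add_mul, add_mul, hself, hself, zero_add, add_zero] at this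
      exact eq_neg_of_add_eq_zero_right this
    refine ⟨hxy, ?_⟩
    change LAlg.mk p y * LAlg.mk p x ∈ (canonicalExtension p G).image H.1
    rw [hswap]
    exact Submodule.neg_mem _ hxy

end Parts

end UCSIAC

theorem theorem1p1 (p : ℕ) [Fact p.Prime] [Fact (p ≠ 2)] :
    -- `G ↦ L(G)` is a well-defined bijection between isomorphism classes
    (∃ F : UCSClasses.{u} p → IACClasses.{u} p, Function.Bijective F ∧
      ∀ (G : Type u) [Group G] [Finite G] [IsUCSPSq p G],
        ∃ h : IsIAC (ZMod p) (LAlg p G),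
          F (UCSClasses.mk p G) = IACClasses.mk p (LAlg p G) h) ∧
    ∀ (G : Type u) [Group G] [Finite G] [IsUCSPSq p G],
      -- (a) automorphism groups
      ((∃ e : MulAut G ⧸ frattiniAut G ≃* algAut (ZMod p) (LAlg p G),
          ∀ (α : MulAut G) (g : G),
            (e (α : MulAut G ⧸ frattiniAut G) : LAlg p G ≃ₗ[ZMod p] LAlg p G) (LAlg.mk p g)
              = LAlg.mk p (α g)) ∧
        (∀ α ∈ frattiniAut G, ∀ β ∈ frattiniAut G, α * β = β * α) ∧
        (∀ α ∈ frattiniAut G, α ^ p = 1) ∧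
        Nat.card (frattiniAut G) = p ^ (Group.rank G ^ 2) ∧
        Module.finrank (ZMod p) (LAlg p G) = Group.rank G ∧
        ((∃ x y : G, x * y ≠ y * x) → centralAut G = frattiniAut G)) ∧
      -- (b) and (c) powerful subgroups and subalgebras, powerfully embedded subgroups and ideals
      (∃ e : {H : Subgroup G // frattini G ≤ H ∧ IsPowerful p H} ≃
            NonUnitalSubalgebra (ZMod p) (LAlg p G),
          (∀ H, (e H : Set (LAlg p G)) = LAlg.mk p '' (H.1 : Set G)) ∧
          (∀ H, IsIdealOf (e H) ↔ IsPowerfullyEmbedded p H.1) ∧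
          ∀ H : Subgroup G, frattini G ≤ H → IsPowerfullyEmbedded p H → IsPowerful p H) ∧
      -- (d) direct powers
      ∀ k : ℕ, 1 ≤ k →
        ∃ _ : IsUCSPSq p (Fin k → G),
          AlgIso (ZMod p) (LAlg p (Fin k → G)) (Fin k → LAlg p G) := by
  refine ⟨⟨classMap p, classMap_bijective p, fun G _ _ _ => ⟨isIAC_LAlg p G, rfl⟩⟩,
    fun G _ _ _ => ⟨⟨exists_autEquiv p G, fun α hα β hβ => frattiniAut_comm p G α β hα hβ,
      frattiniAut_pow p G, card_frattiniAut p G, finrank_LAlg p G,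
      centralAut_eq_frattiniAut p G⟩,
      ⟨powerfulEquiv p G, fun H => rfl, isIdealOf_powerfulEquiv_iff p G,
        fun H _ h => (Subgroup.commutator_mono le_rfl le_top).trans h⟩,
      fun k hk => ?_⟩⟩
  have : Nonempty (Fin k) := ⟨⟨0, hk⟩⟩
  let D := (canonicalExtension p G).pi (Fin k)
  have hU : IsUCSPSq p (Fin k → G) := D.isUCSPSq ((isIAC_LAlg p G).pi (Fin k))
  exact ⟨hU, D.algIso_LAlg⟩
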